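/- Let $m\in\mathbb N$ and let $a_1,\dots,a_m$ be alternatives. A ranking is a linear order $R=a_{i_1}\succ\dots\succ a_{i_m}$, with $a_{i_t}$ at position $t$. The parameter space is $\Theta=\{\theta\in\mathbb R^m:\theta_m=0\}$, and the Plackett–Luce model with parameter $\theta\in\Theta$ assigns to $R$ the probability $\Pr(R\mid\theta)=\prod_{t=1}^{m-1} e^{\theta_{i_t}}/\sum_{l=t}^m e^{\theta_{i_l}}$; let $p_{ii'}(\theta)$ be the probability that $a_i$ is ranked above $a_{i'}$. A breaking $\mathcal G=\{g_{kl}\}$ is a weighted undirected graph without loops, with weights $g_{kl}=g_{lk}\ge 0$, on the set $\{1,\dots,m\}$ of positions; it is nonempty if some weight is positive. For $1\le k\le m-1$ the position-$k$ breaking has exactly the edges $\{k,l\}$, $l>k$, each of weight $1$; $\mathcal G$ is a weighted union of position-$k$ breakings if it is a linear combination of them with nonnegative coefficients. A CML-weight vector $\mathcal W$ consists of a weight $w_{ii'}\ge 0$ for each ordered pair of distinct alternatives. It is symmetric if $w_{ii'}=w_{i'i}$ for all $i\ne i'$, and connected if the undirected graph on the alternatives in which $i\neq i'$ are adjacent whenever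 $w_{ii'}>0$ or $w_{i'i}>0$ is connected. For a profile $P=(R_1,\dots,R_n)$ of rankings let $\kappa_{ii'}=\frac1n\sum_{j} g_{kl}$, the sum running over those $j$ for which $a_i$ is ranked above $a_{i'}$ in $R_j$, where $k<l$ are the positions of $a_i$ and $a_{i'}$ in $R_j$. Let $$\mathrm{CLL}(\theta,P)=\sum_{i\ne i'}\kappa_{ii'}\,w_{ii'}\ln p_{ii'}(\theta),\qquad \mathrm{RBCML}(\mathcal G,\mathcal W)(P)=\arg\max_{\theta\in\Theta}\mathrm{CLL}(\theta,P)\subseteq\Theta .$$ $\mathrm{RBCML}(\mathcal G,\mathcal W)$ is consistent if for every $\theta_0\in\Theta$ and every $\varepsilon>0$, when $R_1,\dots,R_n$ are drawn independently from the Plackett–Luce model with parameter $\theta_0$, the probability that a maximizer exists and every maximizer $\theta$ satisfies $|\theta_i-\theta_{0,i}|<\varepsilon$ for all $i$ tends to $1$ as $n\to\infty$. **Theorem.** Let $\mathcal G$ be a nonempty breaking and $\mathcal W$ a CML-weight vector. For the Plackett–Luce model, $\mathrm{RBCML}(\mathcal G,\mathcal W)$ is consistent if and only if $\mathcal G$ is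 a weighted union of position-$k$ breakings and $\mathcal W$ is connected and symmetric. -/

import Mathlib

namespace RBCML

/-- A ranking (linear order) of the alternatives `a_0, …, a_{m-1}`: `R t` is the alternative at
position `t` (position `0` is the top), and `R.symm i` is the position of alternative `i`. -/
abbrev Ranking (m : ℕ) : Type := Equiv.Perm (Fin m)

/-- A preference profile of `n` rankings over `m` alternatives. -/
abbrev Profile (m n : ℕ) : Type := Fin n → Ranking m

/-- Alternative `i` is ranked higher than alternative `j` in `R`. -/
def Ranking.Prefers {m : ℕ} (R : Ranking m) (i j : Fin m) : Prop := R.symm i < R.symm j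

/-- A weighted rank-breaking: a weighted undirected loopless graph over the positions of a ranking,
with nonnegative weights (weight zero means that there is no edge). -/
structure Breaking (m : ℕ) where
  weight : Fin m → Fin m → ℝ
  symm : ∀ k l, weight k l = weight l k
  loopless : ∀ k, weight k k = 0
  nonneg : ∀ k l, 0 ≤ weight k l

/-- The breaking has at least one edge. -/
def Breaking.Nonempty {m : ℕ} (G : Breaking m) : Prop := ∃ k l, 0 < G.weight k l

/-- The position-`k` breaking: a unit-weight edge between `k` and every later position `l > k`.
(For the last position `k` this graph has no edges.) -/
def positionBreaking {m : ℕ} (k : Fin m) : Breaking m where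
  weight i j := if (i = k ∧ k < j) ∨ (j = k ∧ k < i) then 1 else 0
  symm i j := by simp only [or_comm]
  loopless i := by
    rw [if_neg]
    rintro (⟨rfl, h⟩ | ⟨rfl, h⟩) <;> exact lt_irrefl _ h
  nonneg i j := by split_ifs <;> norm_num

/-- `G` is a weighted union of position-`k` breakings. -/
def Breaking.IsWeightedUnion {m : ℕ} (G : Breaking m) : Prop :=
  ∃ c : Fin m → ℝ, (∀ k, 0 ≤ c k) ∧
    ∀ i j, G.weight i j = ∑ k, c k * (positionBreaking k).weight i j

/-- A CML-weight vector: a nonnegative weight `w i j` for every ordered pair of distinct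
alternatives (the diagonal values are never used). -/
structure CMLWeight (m : ℕ) where
  weight : Fin m → Fin m → ℝ
  nonneg : ∀ i j, 0 ≤ weight i j

def CMLWeight.IsSymmetric {m : ℕ} (W : CMLWeight m) : Prop :=
  ∀ i j, i ≠ j → W.weight i j = W.weight j i

/-- Connectedness of the weighted directed graph `W` on the alternatives: after removing the
directions on all edges (pairs of positive weight), the resulting undirected graph is connected. -/
def CMLWeight.IsConnected {m : ℕ} (W : CMLWeight m) : Prop :=
  (SimpleGraph.fromRel fun i j => 0 < W.weight i j).Connected

/-- The parameter space: real vectors whose last coordinate is normalized to `0`. -/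
def paramSpace (m : ℕ) : Set (Fin m → ℝ) := {θ | ∀ i : Fin m, (i : ℕ) + 1 = m → θ i = 0}

/-- The Plackett–Luce probability of the ranking `R`:
`∏ₜ exp (θ_{R t}) / ∑_{l ≥ t} exp (θ_{R l})` (the factor of the last position is `1`). -/
noncomputable def plProb {m : ℕ} (θ : Fin m → ℝ) (R : Ranking m) : ℝ :=
  ∏ t, Real.exp (θ (R t)) / ∑ l ∈ Finset.Ici t, Real.exp (θ (R l))

/-- The probability of an event for `n` rankings drawn i.i.d. from Plackett–Luce. -/
noncomputable def profileProb {m n : ℕ} (θ : Fin m → ℝ) (E : Set (Profile m n)) : ℝ :=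
  ∑ P : Profile m n, E.indicator (fun P => ∏ s, plProb θ (P s)) P

open Classical in
/-- The marginal probability that `i` is ranked higher than `j` under Plackett–Luce. -/
noncomputable def pairProb {m : ℕ} (θ : Fin m → ℝ) (i j : Fin m) : ℝ :=
  ∑ R : Ranking m, if R.Prefers i j then plProb θ R else 0

open Classical in
/-- The weight of the comparison `i ≻ j` that the breaking `G` extracts from `R`: the weight of the
edge between the positions of `i` and `j` if `R` ranks `i` above `j`, and `0` otherwise. -/
noncomputable def Breaking.extract {m : ℕ} (G : Breaking m) (R : Ranking m) (i j : Fin m) : ℝ :=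
  if R.Prefers i j then G.weight (R.symm i) (R.symm j) else 0

/-- `κ i j`: the average over the profile of the extracted weights of `i ≻ j`. -/
noncomputable def kappa {m n : ℕ} (G : Breaking m) (P : Profile m n) (i j : Fin m) : ℝ :=
  (∑ s, G.extract (P s) i j) / n

/-- The composite log-marginal likelihood `∑_{i ≠ j} κ i j * w i j * log (p i j)`. -/
noncomputable def cll {m n : ℕ} (G : Breaking m) (W : CMLWeight m) (P : Profile m n)
    (θ : Fin m → ℝ) : ℝ :=
  ∑ i, ∑ j ∈ Finset.univ.filter (fun j => i ≠ j),
    kappa G P i j * W.weight i j * Real.log (pairProb θ i j)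

/-- The output of RBCML`(G, W)` on a profile: the set of maximizers, over the parameter space, of
the composite log-marginal likelihood. -/
def rbcml {m n : ℕ} (G : Breaking m) (W : CMLWeight m) (P : Profile m n) : Set (Fin m → ℝ) :=
  {θ | θ ∈ paramSpace m ∧ IsMaxOn (cll G W P) (paramSpace m) θ}

/-- Consistency of RBCML`(G, W)` for Plackett–Luce: for every ground truth `θ₀`, the output
converges in probability to `θ₀`. As the output is a set of maximizers, this says that with
probability tending to one a maximizer exists and every maximizer is `ε`-close to `θ₀`. -/
def IsConsistent {m : ℕ} (G : Breaking m) (W : CMLWeight m) : Prop :=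
  ∀ θ₀ ∈ paramSpace m, ∀ ε : ℝ, 0 < ε →
    Filter.Tendsto
      (fun n : ℕ => profileProb θ₀ {P : Profile m n |
        (rbcml G W P).Nonempty ∧ ∀ θ ∈ rbcml G W P, ∀ i, |θ i - θ₀ i| < ε})
      Filter.atTop (nhds 1)

end RBCML

namespace RBCML

open Finset Filter Topology

variable {m : ℕ}

/-! The extracted weights obey a law of large numbers, so for large `n` the composite likelihood is
close to `logLik W (meanKappa θ₀ G)`. Pairwise marginals are logistic (`pairProb_eq`), so this limit
is concave, and what matters is whether `θ₀` is its unique maximizer on the parameter space.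

Sufficiency. In a weighted union of position-`k` breakings the weight of an edge depends only on its
upper position. Given what precedes that position, `i` and `j` compete for it with odds `exp (θ i) :
exp (θ j)`, so the expected weights of `i ≻ j` and `j ≻ i` have the odds of the pairwise marginals
(`exp_mul_meanKappa`). With `W` symmetric, the loss from leaving `θ₀` is a nonnegative combination
of binary Kullback–Leibler divergences, and connectedness makes it positive (`logLik_lt_of_ne`).
Concavity and compactness carry this over to samples.

Necessity. If `W` is disconnected, shifting a component preserves the objective and spoils
uniqueness. Moreover, consistency makes every `θ` a maximizer of its own expected objective, hence a
zero of the gradient (`stationarity_of_isMax`). Let the weights `exp (θ j)` be `t ^ 4` for the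
alternatives before position `k`, `t ^ 2` at `k`, `t` at the next `r` positions and `1` afterwards,
with `t → ∞`. In the equation for the alternative `i` at `k`, only the sorted rankings and those
with `k`, `k + 1` exchanged contribute at order `1 / t`. With `s` running over the `r` level-one
alternatives, this gives `weight_identity`: `(∑ w i s) * ∑ g k l = r * g k (k+1) * ∑ w s i`, where
`k < l ≤ k + r`. The case `r = 1` yields symmetry of `W`; varying `r` then makes `g k l` independent
of `l > k`. -/

/-- The total weight of the alternatives at positions `≥ s`. -/
noncomputable def tailSum (θ : Fin m → ℝ) (R : Ranking m) (s : Fin m) : ℝ :=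
  ∑ l ∈ Ici s, Real.exp (θ (R l))

/-- The Plackett–Luce probability of the first `n` positions of `R`. -/
noncomputable def prefixProb (θ : Fin m → ℝ) (n : ℕ) (R : Ranking m) : ℝ :=
  ∏ t ∈ univ.filter (fun t : Fin m => (t : ℕ) < n), Real.exp (θ (R t)) / tailSum θ R t

/-! ### Marginals of Plackett–Luce and the odds of extracted weights -/

section PlackettLuce

variable (θ : Fin m → ℝ)

lemma tailSum_pos (R : Ranking m) (s : Fin m) : 0 < tailSum θ R s :=
  sum_pos (fun _ _ => Real.exp_pos _) ⟨s, by simp⟩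

lemma plProb_eq (R : Ranking m) : plProb θ R = ∏ t, Real.exp (θ (R t)) / tailSum θ R t := rfl

lemma plProb_pos (R : Ranking m) : 0 < plProb θ R :=
  prod_pos fun _ _ => div_pos (Real.exp_pos _) (tailSum_pos θ R _)

lemma prefixProb_card (R : Ranking m) : prefixProb θ m R = plProb θ R := by
  simp [prefixProb, plProb_eq]

lemma prefixProb_succ (R : Ranking m) (k : Fin m) :
    prefixProb θ (k + 1) R = prefixProb θ k R * (Real.exp (θ (R k)) / tailSum θ R k) := by
  have : univ.filter (fun t : Fin m => (t : ℕ) < k + 1)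
      = insert k (univ.filter (fun t : Fin m => (t : ℕ) < k)) := by
    ext t; simp [Fin.ext_iff]; omega
  rw [prefixProb, this, prod_insert (by simp), mul_comm, prefixProb]

lemma tailSum_mul_swap (R : Ranking m) {a b s : Fin m} (ha : s ≤ a) (hb : s ≤ b) :
    tailSum θ (R * Equiv.swap a b) s = tailSum θ R s := by
  refine sum_equiv (Equiv.swap a b) (fun l => ?_) (fun l _ => rfl)
  simp only [mem_Ici]
  by_cases h1 : l = a
  · subst h1; simp [ha, hb]
  by_cases h2 : l = b
  · subst h2; simp [ha, hb]
  rw [Equiv.swap_apply_of_ne_of_ne h1 h2]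

lemma prefixProb_mul_swap (R : Ranking m) {n : ℕ} {a b : Fin m} (ha : n ≤ a) (hb : n ≤ b) :
    prefixProb θ n (R * Equiv.swap a b) = prefixProb θ n R := by
  refine prod_congr rfl fun t ht => ?_
  have ht : (t : ℕ) < n := by simpa using ht
  rw [tailSum_mul_swap θ R (Fin.le_def.2 (by omega)) (Fin.le_def.2 (by omega)),
    Equiv.Perm.mul_apply, Equiv.swap_apply_of_ne_of_ne]
  · rintro rfl; omega
  · rintro rfl; omega

/-- Exchanging positions `k` and `l ≥ k` replaces the numerator of the factor at `k` by the weight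
of the alternative at `l`. Summing over the `m - k` choices of `l` turns that factor into `1`. -/
lemma sum_mul_prefixProb_succ (k : Fin m) (f : Ranking m → ℝ)
    (hf : ∀ R (a b : Fin m), k ≤ a → k ≤ b → f (R * Equiv.swap a b) = f R) :
    ∑ R, f R * prefixProb θ k R = ((m - k : ℕ) : ℝ) * ∑ R, f R * prefixProb θ (k + 1) R := by
  have key : ∀ l ∈ Ici k, ∑ R, f R * prefixProb θ (k + 1) R
      = ∑ R, f R * prefixProb θ k R * (Real.exp (θ (R l)) / tailSum θ R k) := by
    intro l hl
    have hl : k ≤ l := by simpa using hl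
    refine Fintype.sum_equiv (Equiv.mulRight (Equiv.swap k l)) _ _ fun R => ?_
    simp only [Equiv.coe_mulRight]
    rw [hf R k l le_rfl hl, prefixProb_mul_swap θ R le_rfl hl, tailSum_mul_swap θ R le_rfl hl,
      prefixProb_succ, mul_assoc]
    simp
  have h2 := sum_congr rfl key
  rw [sum_const, Fin.card_Ici, nsmul_eq_mul] at h2
  rw [h2, sum_comm]
  refine sum_congr rfl fun R _ => ?_
  rw [← mul_sum, ← sum_div]
  change _ = _ * (tailSum θ R k / tailSum θ R k)
  rw [div_self (tailSum_pos θ R k).ne', mul_one]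

/-- Each prefix of length `n` is shared by `d!` rankings, so an observable of the prefix can be
averaged with the prefix probability alone. -/
lemma sum_mul_prefixProb (d n : ℕ) (h : n + d = m) (f : Ranking m → ℝ)
    (hf : ∀ R (a b : Fin m), n ≤ (a : ℕ) → n ≤ (b : ℕ) → f (R * Equiv.swap a b) = f R) :
    ∑ R, f R * prefixProb θ n R = (d.factorial : ℝ) * ∑ R, f R * plProb θ R := by
  induction d generalizing n with
  | zero => obtain rfl : n = m := by omega
            simp [prefixProb_card]
  | succ d ih =>
    have := sum_mul_prefixProb_succ θ (⟨n, by omega⟩ : Fin m) f (fun R a b ha hb => hf R a b ha hb)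
    simp only at this
    rw [this, ih (n + 1) (by omega) (fun R a b ha hb => hf R a b (by omega) (by omega)),
      show m - n = d + 1 by omega, Nat.factorial_succ]
    push_cast; ring

lemma sum_plProb : ∑ R, plProb θ R = 1 := by
  have := sum_mul_prefixProb θ m 0 (by omega) (fun _ => 1) (fun _ _ _ _ _ => rfl)
  simp only [one_mul, prefixProb, Nat.not_lt_zero, filter_false, prod_empty, sum_const,
    card_univ, Fintype.card_perm, Fintype.card_fin, nsmul_eq_mul, mul_one] at this
  have h : (m.factorial : ℝ) ≠ 0 := by positivity
  field_simp at this
  linarith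

/-- Given what is ranked at the positions before `k`, the chances of `i` and `j` to be ranked at
position `k` are proportional to `exp (θ i)` and `exp (θ j)`. -/
lemma exp_mul_sum_position (k : Fin m) (i j : Fin m) :
    Real.exp (θ j) * ∑ R : Ranking m, (if R k = i ∧ k < R.symm j then plProb θ R else 0) =
    Real.exp (θ i) * ∑ R : Ranking m, (if R k = j ∧ k < R.symm i then plProb θ R else 0) := by
  -- The event depends only on positions up to `k`, so `prefixProb` at `k + 1` suffices; its last
  -- factor, times `exp (θ j)`, is symmetric in `i` and `j`.
  have main : ∀ i j : Fin m, Real.exp (θ j) *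
      (((m - (k + 1)).factorial : ℝ) *
        ∑ R : Ranking m, (if R k = i ∧ k < R.symm j then plProb θ R else 0)) =
      ∑ R : Ranking m, (if R k = i ∧ k < R.symm j then
        prefixProb θ k R * (Real.exp (θ i) * Real.exp (θ j) / tailSum θ R k) else 0) := by
    intro i j
    have := sum_mul_prefixProb θ (m - (k + 1)) (k + 1) (by omega)
      (fun R => if R k = i ∧ k < R.symm j then 1 else 0) (fun R a b ha hb => by
        have hk : (R * Equiv.swap a b) k = R k := by
          rw [Equiv.Perm.mul_apply, Equiv.swap_apply_of_ne_of_ne] <;> rintro rfl <;> omega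
        have hj : k < (R * Equiv.swap a b).symm j ↔ k < R.symm j := by
          change k < Equiv.swap a b (R.symm j) ↔ _
          by_cases h1 : R.symm j = a
          · rw [h1, Equiv.swap_apply_left]; simp only [Fin.lt_def]; omega
          by_cases h2 : R.symm j = b
          · rw [h2, Equiv.swap_apply_right]; simp only [Fin.lt_def]; omega
          rw [Equiv.swap_apply_of_ne_of_ne h1 h2]
        simp only [hk, hj])
    simp only [ite_mul, one_mul, zero_mul] at this
    rw [← this, mul_sum]
    refine sum_congr rfl fun R _ => ?_
    split_ifs with h
    · rw [prefixProb_succ, h.1]; ring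
    · simp
  have hpos : ((m - (k + 1)).factorial : ℝ) ≠ 0 := by positivity
  refine mul_left_cancel₀ hpos ?_
  rw [mul_left_comm, mul_left_comm _ (Real.exp (θ i)), main i j, main j i]
  refine Fintype.sum_equiv (Equiv.mulLeft (Equiv.swap i j)) _ _ fun R => ?_
  simp only [Equiv.coe_mulLeft]
  have hc : (Equiv.swap i j * R) k = j ∧ k < (Equiv.swap i j * R).symm i ↔
      R k = i ∧ k < R.symm j := by
    change Equiv.swap i j (R k) = j ∧ k < R.symm ((Equiv.swap i j).symm i) ↔ _
    rw [Equiv.symm_swap, Equiv.swap_apply_left, Equiv.swap_apply_eq_iff, Equiv.swap_apply_right]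
  simp only [hc]
  split_ifs with h
  -- Here exchanging the two alternatives is the same as exchanging two positions `≥ k`, which
  -- affects neither the prefix nor the tail sum at `k`.
  · have hR : Equiv.swap i j * R = R * Equiv.swap k (R.symm j) := by
      rw [Equiv.swap_mul_eq_mul_swap, ← h.1]; simp [Equiv.Perm.inv_def]
    rw [hR, prefixProb_mul_swap θ R le_rfl h.2.le, tailSum_mul_swap θ R le_rfl h.2.le,
      mul_comm (Real.exp (θ i))]
  · rfl

/-- The expected weight that the breaking `G` extracts for `i ≻ j` from a Plackett–Luce ranking. -/
noncomputable def meanKappa (G : Breaking m) (i j : Fin m) : ℝ :=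
  ∑ R, plProb θ R * G.extract R i j

lemma sum_prefers_split (c : Fin m → ℝ) (i j : Fin m) :
    ∑ R : Ranking m, (if R.symm i < R.symm j then plProb θ R * c (R.symm i) else 0) =
    ∑ k, c k * ∑ R : Ranking m, (if R k = i ∧ k < R.symm j then plProb θ R else 0) := by
  simp_rw [mul_sum]
  rw [sum_comm]
  refine sum_congr rfl fun R _ => ?_
  rw [sum_eq_single (R.symm i)]
  · simp [mul_comm]
  · intro b _ hb
    rw [if_neg, mul_zero]
    rintro ⟨rfl, -⟩
    simp at hb
  · simp

/-- The proportionality at each fixed position survives any weighting `c` by the position of the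
preferred alternative. -/
lemma exp_mul_sum_prefers (c : Fin m → ℝ) (i j : Fin m) :
    Real.exp (θ j) *
      ∑ R : Ranking m, (if R.symm i < R.symm j then plProb θ R * c (R.symm i) else 0) =
    Real.exp (θ i) *
      ∑ R : Ranking m, (if R.symm j < R.symm i then plProb θ R * c (R.symm j) else 0) := by
  rw [sum_prefers_split, sum_prefers_split, mul_sum, mul_sum]
  refine sum_congr rfl fun k _ => ?_
  rw [mul_left_comm, exp_mul_sum_position θ k i j, mul_left_comm]

lemma pairProb_eq {i j : Fin m} (hij : i ≠ j) :
    pairProb θ i j = Real.exp (θ i) / (Real.exp (θ i) + Real.exp (θ j)) := by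
  have h1 := exp_mul_sum_prefers θ (fun _ => 1) i j
  simp only [mul_one] at h1
  have e1 : ∀ i j, pairProb θ i j =
      ∑ R : Ranking m, (if R.symm i < R.symm j then plProb θ R else 0) := fun i j => by
    unfold pairProb Ranking.Prefers
    exact sum_congr rfl fun R _ => by congr
  have h2 : pairProb θ i j + pairProb θ j i = 1 := by
    rw [← sum_plProb θ, e1, e1, ← sum_add_distrib]
    refine sum_congr rfl fun R _ => ?_
    have : R.symm i ≠ R.symm j := fun h => hij (R.symm.injective h)
    rcases lt_or_gt_of_ne this with h | h
    · simp [h, h.not_gt]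
    · simp [h, h.not_gt]
  rw [← e1, ← e1] at h1
  have := Real.exp_pos (θ i)
  have := Real.exp_pos (θ j)
  rw [eq_div_iff (by positivity)]
  have h3 : pairProb θ j i = 1 - pairProb θ i j := by linarith
  rw [h3] at h1
  linarith

lemma weight_eq_of_lt {G : Breaking m} {c : Fin m → ℝ}
    (hc : ∀ i j, G.weight i j = ∑ k, c k * (positionBreaking k).weight i j) {a b : Fin m}
    (h : a < b) : G.weight a b = c a := by
  rw [hc, sum_eq_single a]
  · simp [positionBreaking, h]
  · intro k _ hk
    have : ¬ ((a = k ∧ k < b) ∨ (b = k ∧ k < a)) := by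
      rintro (⟨rfl, -⟩ | ⟨rfl, h'⟩)
      · exact hk rfl
      · exact lt_asymm h h'
    simp [positionBreaking, this]
  · simp

/-- For a weighted union the edge weight is a function of the upper position only, so
`exp_mul_sum_prefers` applies with that function as `c`. -/
lemma exp_mul_meanKappa {G : Breaking m} (hG : G.IsWeightedUnion) (i j : Fin m) :
    Real.exp (θ j) * meanKappa θ G i j = Real.exp (θ i) * meanKappa θ G j i := by
  obtain ⟨c, -, hc⟩ := hG
  have e : ∀ i j, meanKappa θ G i j =
      ∑ R : Ranking m, (if R.symm i < R.symm j then plProb θ R * c (R.symm i) else 0) := by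
    intro i j
    refine sum_congr rfl fun R _ => ?_
    unfold Breaking.extract Ranking.Prefers
    by_cases h : R.symm i < R.symm j
    · simp only [h, if_true]; rw [weight_eq_of_lt hc h]
    · simp [h]
  rw [e, e, exp_mul_sum_prefers θ c i j]

lemma extract_nonneg (G : Breaking m) (R : Ranking m) (i j : Fin m) : 0 ≤ G.extract R i j := by
  unfold Breaking.extract
  split_ifs
  · exact G.nonneg _ _
  · exact le_rfl

lemma Breaking.Nonempty.exists_lt {G : Breaking m} (hG : G.Nonempty) :
    ∃ k l, k < l ∧ 0 < G.weight k l := by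
  obtain ⟨k, l, hw⟩ := hG
  rcases lt_trichotomy k l with h | rfl | h
  · exact ⟨k, l, h, hw⟩
  · simp [G.loopless] at hw
  · exact ⟨l, k, h, G.symm k l ▸ hw⟩

lemma exists_ranking {k l i j : Fin m} (hkl : k ≠ l) (hij : i ≠ j) :
    ∃ R : Ranking m, R k = i ∧ R l = j := by
  refine ⟨Equiv.swap j (Equiv.swap k i l) * Equiv.swap k i, ?_, by simp⟩
  rw [Equiv.Perm.mul_apply, Equiv.swap_apply_left, Equiv.swap_apply_of_ne_of_ne hij]
  rw [Ne, eq_comm, Equiv.swap_apply_eq_iff, Equiv.swap_apply_right]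
  exact hkl.symm

lemma meanKappa_pos {G : Breaking m} (hG : G.Nonempty) {i j : Fin m} (hij : i ≠ j) :
    0 < meanKappa θ G i j := by
  obtain ⟨k, l, hkl, hw⟩ := hG.exists_lt
  obtain ⟨R, hRk, hRl⟩ := exists_ranking hkl.ne hij
  refine sum_pos' (fun R _ => mul_nonneg (plProb_pos θ R).le (extract_nonneg G R i j))
    ⟨R, mem_univ _, mul_pos (plProb_pos θ R) ?_⟩
  have h1 : R.symm i = k := by rw [← hRk, Equiv.symm_apply_apply]
  have h2 : R.symm j = l := by rw [← hRl, Equiv.symm_apply_apply]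
  simpa [Breaking.extract, Ranking.Prefers, h1, h2, hkl] using hw

end PlackettLuce

/-! ### Moments of i.i.d. samples from a finite law -/

section FiniteIID

variable {Ω : Type*} [Fintype Ω]

lemma sum_fin_succ_arrow {n : ℕ} (F : (Fin (n + 1) → Ω) → ℝ) :
    ∑ P, F P = ∑ r, ∑ Q : Fin n → Ω, F (Fin.cons r Q) := by
  rw [← Fintype.sum_prod_type']
  exact (Fintype.sum_equiv (Fin.consEquiv fun _ => Ω) _ _ fun _ => rfl).symm

lemma sum_prod_arrow (p : Ω → ℝ) (hp : ∑ r, p r = 1) (n : ℕ) : ∑ P : Fin n → Ω, ∏ s, p (P s) = 1 := by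
  induction n with
  | zero => simp
  | succ n ih =>
    rw [sum_fin_succ_arrow]
    simp only [Fin.prod_univ_succ, Fin.cons_zero, Fin.cons_succ]
    simp only [← mul_sum, ih, mul_one, hp]

/-- The variance of a sum of `n` independent copies of a centered variable. -/
lemma sum_prod_mul_sq (p a : Ω → ℝ) (hp : ∑ r, p r = 1) (ha : ∑ r, p r * a r = 0) (n : ℕ) :
    ∑ P : Fin n → Ω, (∏ s, p (P s)) * (∑ s, a (P s)) ^ 2 = n * ∑ r, p r * a r ^ 2 := by
  induction n with
  | zero => simp
  | succ n ih =>
    rw [sum_fin_succ_arrow]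
    simp only [Fin.prod_univ_succ, Fin.sum_univ_succ, Fin.cons_zero, Fin.cons_succ]
    have h : ∀ r, ∑ Q : Fin n → Ω, (p r * ∏ s, p (Q s)) * (a r + ∑ s, a (Q s)) ^ 2 =
        p r * a r ^ 2 + p r * a r * (2 * ∑ Q : Fin n → Ω, (∏ s, p (Q s)) * ∑ s, a (Q s))
          + p r * (n * ∑ r, p r * a r ^ 2) := by
      intro r
      rw [← ih]
      have h0 : p r * a r ^ 2 = p r * a r ^ 2 * ∑ Q : Fin n → Ω, ∏ s, p (Q s) := by
        rw [sum_prod_arrow p hp, mul_one]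
      nth_rewrite 1 [h0]
      simp only [mul_sum, ← sum_add_distrib]
      refine sum_congr rfl fun Q _ => ?_
      simp only [← mul_sum]
      ring
    simp only [h, sum_add_distrib, ← sum_mul, hp, ha]
    push_cast; ring

end FiniteIID

/-! ### Weak law of large numbers for the extracted weights -/

section LawOfLargeNumbers

variable (θ : Fin m → ℝ)

lemma prod_plProb_nonneg {n : ℕ} (P : Profile m n) : 0 ≤ ∏ s, plProb θ (P s) :=
  prod_nonneg fun _ _ => (plProb_pos θ _).le

lemma profileProb_mono {n : ℕ} {E F : Set (Profile m n)} (h : E ⊆ F) :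
    profileProb θ E ≤ profileProb θ F :=
  sum_le_sum fun P _ => Set.indicator_le_indicator_of_subset h (prod_plProb_nonneg θ) P

lemma profileProb_univ (n : ℕ) : profileProb θ (Set.univ : Set (Profile m n)) = 1 := by
  simp only [profileProb, Set.indicator_univ]
  exact sum_prod_arrow _ (sum_plProb θ) n

lemma profileProb_le_one {n : ℕ} (E : Set (Profile m n)) : profileProb θ E ≤ 1 :=
  profileProb_univ θ n ▸ profileProb_mono θ (Set.subset_univ E)

lemma profileProb_add_compl {n : ℕ} (E : Set (Profile m n)) :
    profileProb θ E + profileProb θ Eᶜ = 1 := by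
  rw [← profileProb_univ θ n, profileProb, profileProb, profileProb, ← sum_add_distrib]
  refine sum_congr rfl fun P _ => ?_
  rw [Set.indicator_univ]
  exact congrFun (Set.indicator_self_add_compl E _) P

lemma sum_prod_mul_kappa_sub_sq (G : Breaking m) (i j : Fin m) {n : ℕ} (hn : n ≠ 0) :
    ∑ P : Profile m n, (∏ s, plProb θ (P s)) * (kappa G P i j - meanKappa θ G i j) ^ 2 =
      (∑ R, plProb θ R * (G.extract R i j - meanKappa θ G i j) ^ 2) / n := by
  have hn' : (n : ℝ) ≠ 0 := Nat.cast_ne_zero.2 hn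
  have hc : ∑ R, plProb θ R * (G.extract R i j - meanKappa θ G i j) = 0 := by
    simp only [mul_sub, sum_sub_distrib, ← sum_mul, sum_plProb, one_mul]
    exact sub_self _
  have := sum_prod_mul_sq (plProb θ) (fun R => G.extract R i j - meanKappa θ G i j)
    (sum_plProb θ) hc n
  have e : ∀ P : Profile m n, (kappa G P i j - meanKappa θ G i j) ^ 2 =
      (∑ s, (G.extract (P s) i j - meanKappa θ G i j)) ^ 2 / n ^ 2 := by
    intro P
    rw [sum_sub_distrib, kappa]
    simp only [sum_const, card_univ, Fintype.card_fin, nsmul_eq_mul]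
    field_simp
  simp only [e, ← mul_div_assoc]
  rw [← sum_div, this]
  field_simp

/-- The weak law of large numbers for the extracted weights. -/
lemma tendsto_profileProb_kappa (G : Breaking m) {δ : ℝ} (hδ : 0 < δ) :
    Tendsto (fun n : ℕ => profileProb θ
      {P : Profile m n | ∀ i j, |kappa G P i j - meanKappa θ G i j| < δ}) atTop (𝓝 1) := by
  set C : ℝ := ∑ i, ∑ j, ∑ R, plProb θ R * (G.extract R i j - meanKappa θ G i j) ^ 2
  have lower : ∀ᶠ n : ℕ in atTop, 1 - C / δ ^ 2 / n ≤ profileProb θ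
      {P : Profile m n | ∀ i j, |kappa G P i j - meanKappa θ G i j| < δ} := by
    filter_upwards [eventually_ne_atTop 0] with n hn
    set E := {P : Profile m n | ∀ i j, |kappa G P i j - meanKappa θ G i j| < δ}
    have key : profileProb θ Eᶜ ≤ C / δ ^ 2 / n := by
      have : C / δ ^ 2 / n = ∑ P : Profile m n, (∏ s, plProb θ (P s)) *
          ((∑ i, ∑ j, (kappa G P i j - meanKappa θ G i j) ^ 2) / δ ^ 2) := by
        have hC : ∑ P : Profile m n, (∏ s, plProb θ (P s)) *
            (∑ i, ∑ j, (kappa G P i j - meanKappa θ G i j) ^ 2) = C / n := by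
          simp only [mul_sum]
          rw [sum_comm, sum_div]
          refine sum_congr rfl fun i _ => ?_
          rw [sum_comm, sum_div]
          exact sum_congr rfl fun j _ => sum_prod_mul_kappa_sub_sq θ G i j hn
        simp only [← mul_div_assoc]
        rw [← sum_div, hC, div_right_comm]
      rw [this]
      -- Chebyshev: on the bad event some squared deviation is at least `δ ^ 2`, so the quotient
      -- dominates the indicator.
      refine sum_le_sum fun P _ => ?_
      have hs : 0 ≤ ∑ i, ∑ j, (kappa G P i j - meanKappa θ G i j) ^ 2 :=
        sum_nonneg fun i _ => sum_nonneg fun j _ => sq_nonneg _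
      by_cases hP : P ∈ Eᶜ
      · rw [Set.indicator_of_mem hP]
        refine le_mul_of_one_le_right (prod_plProb_nonneg θ P) ?_
        obtain ⟨i, j, hij⟩ : ∃ i j, δ ≤ |kappa G P i j - meanKappa θ G i j| := by
          simpa [E] using hP
        rw [one_le_div (by positivity)]
        calc δ ^ 2 ≤ |kappa G P i j - meanKappa θ G i j| ^ 2 := by gcongr
          _ = (kappa G P i j - meanKappa θ G i j) ^ 2 := sq_abs _
          _ ≤ ∑ j, (kappa G P i j - meanKappa θ G i j) ^ 2 :=
            single_le_sum (f := fun j => (kappa G P i j - meanKappa θ G i j) ^ 2)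
              (fun j _ => sq_nonneg _) (mem_univ j)
          _ ≤ _ := single_le_sum
              (f := fun i => ∑ j, (kappa G P i j - meanKappa θ G i j) ^ 2)
              (fun i _ => sum_nonneg fun j _ => sq_nonneg _) (mem_univ i)
      · rw [Set.indicator_of_notMem hP]
        exact mul_nonneg (prod_plProb_nonneg θ P) (by positivity)
    linarith [profileProb_add_compl θ E]
  have hlim : Tendsto (fun n : ℕ => 1 - C / δ ^ 2 / n) atTop (𝓝 1) := by
    simpa using (tendsto_const_div_atTop_nhds_zero_nat (C / δ ^ 2)).const_sub 1
  exact tendsto_of_tendsto_of_tendsto_of_le_of_le' hlim tendsto_const_nhds lower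
    (Eventually.of_forall fun n => profileProb_le_one θ _)

end LawOfLargeNumbers

/-! ### Concavity, continuity and localization of the maximizers -/

/-- The composite log-likelihood with extracted weights `K`, with `log (p i j)` in closed form. -/
noncomputable def logLik (W : CMLWeight m) (K : Fin m → Fin m → ℝ) (θ : Fin m → ℝ) : ℝ :=
  ∑ i, ∑ j ∈ univ.filter (fun j => i ≠ j),
    K i j * W.weight i j * -Real.log (1 + Real.exp (θ j - θ i))

lemma log_pairProb (θ : Fin m → ℝ) {i j : Fin m} (hij : i ≠ j) :
    Real.log (pairProb θ i j) = -Real.log (1 + Real.exp (θ j - θ i)) := by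
  rw [pairProb_eq θ hij, ← Real.log_inv, Real.exp_sub]
  congr 1
  have := Real.exp_pos (θ i)
  field_simp

lemma cll_eq_logLik {n : ℕ} (G : Breaking m) (W : CMLWeight m) (P : Profile m n) :
    cll G W P = logLik W (kappa G P) := by
  funext θ
  refine sum_congr rfl fun i _ => sum_congr rfl fun j hj => ?_
  rw [log_pairProb θ (by simpa using hj)]

lemma kappa_nonneg {n : ℕ} (G : Breaking m) (P : Profile m n) (i j : Fin m) :
    0 ≤ kappa G P i j :=
  div_nonneg (sum_nonneg fun _ _ => extract_nonneg G _ i j) (Nat.cast_nonneg n)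

lemma convexOn_log_one_add_exp :
    ConvexOn ℝ Set.univ fun u : ℝ => Real.log (1 + Real.exp u) := by
  have hd : ∀ u : ℝ, HasDerivAt (fun u : ℝ => Real.log (1 + Real.exp u))
      (Real.exp u / (1 + Real.exp u)) u := fun u =>
    ((Real.hasDerivAt_exp u).const_add 1).log (by positivity)
  refine Monotone.convexOn_univ_of_deriv (fun u => (hd u).differentiableAt) fun u v huv => ?_
  rw [(hd u).deriv, (hd v).deriv, div_le_div_iff₀ (by positivity) (by positivity)]
  have := Real.exp_le_exp.2 huv
  nlinarith

lemma concaveOn_logLik (W : CMLWeight m) {K : Fin m → Fin m → ℝ} (hK : ∀ i j, 0 ≤ K i j) :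
    ConcaveOn ℝ Set.univ (logLik W K) := by
  refine ⟨convex_univ, fun θ _ φ _ a b ha hb hab => ?_⟩
  simp only [logLik, smul_eq_mul, mul_sum, ← sum_add_distrib]
  refine sum_le_sum fun i _ => sum_le_sum fun j _ => ?_
  have h := convexOn_log_one_add_exp.2 (Set.mem_univ (θ j - θ i)) (Set.mem_univ (φ j - φ i))
    ha hb hab
  have e : (a • θ + b • φ) j - (a • θ + b • φ) i = a • (θ j - θ i) + b • (φ j - φ i) := by
    simp only [Pi.add_apply, Pi.smul_apply, smul_eq_mul]; ring
  rw [e]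
  simp only [smul_eq_mul] at h ⊢
  have := mul_le_mul_of_nonneg_left h (mul_nonneg (hK i j) (W.nonneg i j))
  linarith

lemma continuous_logLik (W : CMLWeight m) :
    Continuous fun x : (Fin m → Fin m → ℝ) × (Fin m → ℝ) => logLik W x.1 x.2 := by
  unfold logLik
  refine continuous_finsetSum _ fun i _ => continuous_finsetSum _ fun j _ => ?_
  refine Continuous.mul (by fun_prop) (Continuous.neg (Continuous.log (by fun_prop) fun x => ?_))
  positivity

lemma isClosed_paramSpace : IsClosed (paramSpace m) := by
  simp only [paramSpace, Set.ofPred_forall]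
  exact isClosed_iInter fun i => isClosed_iInter fun _ =>
    isClosed_eq (continuous_apply i) continuous_const

/-- If `θ₀` beats the rest of the sphere of radius `ε` around it, then by concavity the maximizers
exist and lie in the ball. -/
lemma maximizers_near_of_sphere (W : CMLWeight m) {K : Fin m → Fin m → ℝ}
    (hK : ∀ i j, 0 ≤ K i j) {θ₀ : Fin m → ℝ} (h₀ : θ₀ ∈ paramSpace m) {ε : ℝ} (hε : 0 < ε)
    (h : ∀ θ ∈ Metric.sphere θ₀ ε ∩ paramSpace m, logLik W K θ < logLik W K θ₀) :
    (∃ θ ∈ paramSpace m, IsMaxOn (logLik W K) (paramSpace m) θ) ∧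
      ∀ θ ∈ paramSpace m, IsMaxOn (logLik W K) (paramSpace m) θ → dist θ θ₀ < ε := by
  have far : ∀ θ ∈ paramSpace m, ε ≤ dist θ θ₀ → logLik W K θ < logLik W K θ₀ := by
    intro θ hθ hd
    by_contra! hle
    have hd0 : 0 < dist θ θ₀ := hε.trans_le hd
    -- The parameter at which the segment from `θ₀` to `θ` crosses the sphere; concavity would give
    -- a value there at least that of `θ₀`.
    set s := ε / dist θ θ₀
    have hs0 : 0 ≤ s := by positivity
    have hs1 : 0 ≤ 1 - s := sub_nonneg.2 ((div_le_one hd0).2 hd)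
    have hz : (1 - s) • θ₀ + s • θ ∈ Metric.sphere θ₀ ε ∩ paramSpace m := by
      constructor
      · have e : (1 - s) • θ₀ + s • θ - θ₀ = s • (θ - θ₀) := by
          rw [sub_smul, smul_sub, one_smul]; abel
        rw [mem_sphere_iff_norm, e, norm_smul, ← dist_eq_norm, Real.norm_of_nonneg hs0]
        exact div_mul_cancel₀ _ hd0.ne'
      · intro i hi
        simp [h₀ i hi, hθ i hi]
    have hc := (concaveOn_logLik W hK).2 (Set.mem_univ θ₀) (Set.mem_univ θ) hs1 hs0
      (by ring : 1 - s + s = 1)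
    have := h _ hz
    simp only [smul_eq_mul] at hc
    nlinarith
  constructor
  · obtain ⟨z, hz, hmax⟩ := ((isCompact_closedBall θ₀ ε).inter_right
      isClosed_paramSpace).exists_isMaxOn ⟨θ₀, Metric.mem_closedBall_self hε.le, h₀⟩
      ((continuous_logLik W).comp (Continuous.prodMk_right K)).continuousOn
    refine ⟨z, hz.2, fun θ hθ => ?_⟩
    by_cases hd : dist θ θ₀ ≤ ε
    · exact hmax ⟨hd, hθ⟩
    · exact (far θ hθ (not_le.1 hd).le).le.trans
        (hmax ⟨Metric.mem_closedBall_self hε.le, h₀⟩)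
  · intro θ hθ hmax
    by_contra! hd
    exact (far θ hθ hd).not_ge (hmax h₀)

/-! ### Sufficiency of the conditions -/

lemma isConnected_const {W : CMLWeight m} (hW : W.IsConnected) {d : Fin m → ℝ}
    (hd : ∀ i j, i ≠ j → 0 < W.weight i j → d i = d j) (i j : Fin m) : d i = d j := by
  obtain ⟨w⟩ := hW.preconnected i j
  induction w with
  | nil => rfl
  | cons h _ ih =>
    rw [← ih]
    rw [SimpleGraph.fromRel_adj] at h
    rcases h with ⟨hne, h | h⟩
    · exact hd _ _ hne h
    · exact (hd _ _ hne.symm h).symm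

/-- The truth is the unique maximizer of the expected composite log-likelihood, if the expected
weights of `i ≻ j` and `j ≻ i` have the right proportion. -/
lemma logLik_lt_of_ne {W : CMLWeight m} (hc : W.IsConnected) (hs : W.IsSymmetric)
    {K : Fin m → Fin m → ℝ} {θ₀ θ : Fin m → ℝ} (hpos : ∀ i j, i ≠ j → 0 < K i j)
    (hK : ∀ i j, Real.exp (θ₀ j) * K i j = Real.exp (θ₀ i) * K j i)
    (h₀ : θ₀ ∈ paramSpace m) (hθ : θ ∈ paramSpace m) (hne : θ ≠ θ₀) :
    logLik W K θ < logLik W K θ₀ := by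
  set p : (Fin m → ℝ) → Fin m → Fin m → ℝ := fun θ i j => (1 + Real.exp (θ j - θ i))⁻¹ with hp
  have hppos : ∀ θ i j, 0 < p θ i j := fun θ i j => by positivity
  have hpadd : ∀ θ i j, p θ i j + p θ j i = 1 := by
    intro θ i j
    simp only [hp, Real.exp_sub]
    have := Real.exp_pos (θ i)
    have := Real.exp_pos (θ j)
    field_simp
    ring
  -- The proportion hypothesis says that `K` splits each pair's total weight according to the true
  -- marginals; differences of the objective become relative entropy terms.
  have hKp : ∀ i j, K i j = (K i j + K j i) * p θ₀ i j := by
    intro i j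
    have := hK i j
    simp only [hp, Real.exp_sub]
    have := Real.exp_pos (θ₀ i)
    have := Real.exp_pos (θ₀ j)
    field_simp
    linarith
  have hterm : ∀ i j, i ≠ j → K i j * W.weight i j * -Real.log (1 + Real.exp (θ j - θ i))
      - K i j * W.weight i j * -Real.log (1 + Real.exp (θ₀ j - θ₀ i))
      = (K i j + K j i) * W.weight i j * (p θ₀ i j * Real.log (p θ i j / p θ₀ i j)) := by
    intro i j hij
    rw [Real.log_div (hppos _ _ _).ne' (hppos _ _ _).ne', ← Real.log_inv, ← Real.log_inv]
    change K i j * _ * Real.log (p θ i j) - K i j * _ * Real.log (p θ₀ i j) = _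
    rw [← mul_sub]
    nth_rewrite 1 [hKp i j]
    ring
  have hle : ∀ i j, p θ₀ i j * Real.log (p θ i j / p θ₀ i j) ≤ p θ i j - p θ₀ i j := by
    intro i j
    have h1 := Real.log_le_sub_one_of_pos (div_pos (hppos θ i j) (hppos θ₀ i j))
    have h2 := mul_le_mul_of_nonneg_left h1 (hppos θ₀ i j).le
    have h3 := hppos θ₀ i j
    calc _ ≤ _ := h2
      _ = _ := by field_simp
  have hlt : ∀ i j, p θ i j ≠ p θ₀ i j →
      p θ₀ i j * Real.log (p θ i j / p θ₀ i j) < p θ i j - p θ₀ i j := by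
    intro i j hne
    have h3 := hppos θ₀ i j
    have h1 := Real.log_lt_sub_one_of_pos (div_pos (hppos θ i j) h3)
      (by rwa [Ne, div_eq_one_iff_eq h3.ne'])
    have h2 := mul_lt_mul_of_pos_left h1 h3
    calc _ < _ := h2
      _ = _ := by field_simp
  -- If no edge of `W` saw its marginal change, `θ - θ₀` would be constant along edges, hence
  -- constant, hence zero by its last coordinate.
  obtain ⟨u, v, huv, hwuv, hdiff⟩ : ∃ u v, u ≠ v ∧ 0 < W.weight u v ∧ p θ u v ≠ p θ₀ u v := by
    by_contra! hcon
    apply hne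
    have hd : ∀ i j, i ≠ j → 0 < W.weight i j → (θ - θ₀) i = (θ - θ₀) j := by
      intro i j hij hw
      have := inv_injective (hcon i j hij hw)
      have := Real.exp_injective (add_left_cancel this)
      simp only [Pi.sub_apply]
      linarith
    funext i
    have hi := i.isLt
    have hz : (θ - θ₀) ⟨m - 1, by omega⟩ = 0 := by
      have e : m - 1 + 1 = m := by omega
      simp [hθ ⟨m - 1, by omega⟩ e, h₀ ⟨m - 1, by omega⟩ e]
    have := isConnected_const hc hd i ⟨m - 1, by omega⟩
    rw [hz] at this
    simpa [sub_eq_zero] using this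
  have hS : ∀ i j, i ≠ j → 0 < K i j + K j i := fun i j hij =>
    add_pos (hpos i j hij) (hpos j i hij.symm)
  -- The linear bounds from `log x ≤ x - 1` cancel between `(i, j)` and `(j, i)`; this is where the
  -- symmetry of `W` enters.
  have hanti : ∑ i, ∑ j ∈ univ.filter (fun j => i ≠ j),
      (K i j + K j i) * W.weight i j * (p θ i j - p θ₀ i j) = 0 := by
    simp only [sum_filter]
    set T := ∑ i, ∑ j, if i ≠ j then (K i j + K j i) * W.weight i j * (p θ i j - p θ₀ i j) else 0
      with hT
    have : T = -T := by
      rw [hT]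
      nth_rewrite 1 [sum_comm]
      simp only [← sum_neg_distrib]
      refine sum_congr rfl fun i _ => sum_congr rfl fun j _ => ?_
      by_cases hij : i = j
      · simp [hij]
      · rw [if_pos hij, if_pos (Ne.symm hij), hs i j hij]
        linear_combination (K i j + K j i) * W.weight j i * (hpadd θ i j - hpadd θ₀ i j)
    linarith
  rw [← sub_neg, ← hanti, logLik, logLik, ← sum_sub_distrib]
  simp only [← sum_sub_distrib]
  have hw : ∀ i j, i ≠ j → 0 ≤ (K i j + K j i) * W.weight i j := fun i j hij =>
    mul_nonneg (hS i j hij).le (W.nonneg i j)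
  refine sum_lt_sum (fun i _ => sum_le_sum fun j hj => ?_)
    ⟨u, mem_univ u, sum_lt_sum (fun j hj => ?_) ⟨v, by simpa using huv, ?_⟩⟩
  · have hj : i ≠ j := by simpa using hj
    rw [hterm i j hj]
    exact mul_le_mul_of_nonneg_left (hle i j) (hw i j hj)
  · have hj : u ≠ j := by simpa using hj
    rw [hterm u j hj]
    exact mul_le_mul_of_nonneg_left (hle u j) (hw u j hj)
  · rw [hterm u v huv]
    exact mul_lt_mul_of_pos_left (hlt u v hdiff) (mul_pos (hS u v huv) hwuv)

lemma isConsistent_of {G : Breaking m} {W : CMLWeight m} (hG : G.Nonempty)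
    (hU : G.IsWeightedUnion) (hc : W.IsConnected) (hs : W.IsSymmetric) : IsConsistent G W := by
  intro θ₀ h₀ ε hε
  -- Strict inequality at the mean weights persists, uniformly on the compact sphere, for all nearby
  -- weights.
  have hsphere : ∀ᶠ K in 𝓝 (meanKappa θ₀ G), ∀ θ ∈ Metric.sphere θ₀ ε ∩ paramSpace m,
      logLik W K θ < logLik W K θ₀ := by
    refine ((isCompact_sphere θ₀ ε).inter_right
      isClosed_paramSpace).eventually_forall_of_forall_eventually fun θ hθ => ?_
    have hlt : logLik W (meanKappa θ₀ G) θ < logLik W (meanKappa θ₀ G) θ₀ := by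
      refine logLik_lt_of_ne hc hs (fun i j hij => meanKappa_pos θ₀ hG hij)
        (exp_mul_meanKappa θ₀ hU) h₀ hθ.2 ?_
      rintro rfl
      simpa using hε.ne (by simpa using hθ.1)
    exact ContinuousAt.eventually_lt (continuous_logLik W).continuousAt
      ((continuous_logLik W).comp (by fun_prop :
        Continuous fun z : (Fin m → Fin m → ℝ) × (Fin m → ℝ) => (z.1, θ₀))).continuousAt hlt
  obtain ⟨δ, hδ, hball⟩ := Metric.eventually_nhds_iff.1 hsphere
  refine tendsto_of_tendsto_of_tendsto_of_le_of_le (tendsto_profileProb_kappa θ₀ G hδ)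
    tendsto_const_nhds (fun n => profileProb_mono θ₀ fun P hP => ?_)
    (fun n => profileProb_le_one θ₀ _)
  have hd : dist (kappa G P) (meanKappa θ₀ G) < δ :=
    (dist_pi_lt_iff hδ).2 fun i => (dist_pi_lt_iff hδ).2 fun j => hP i j
  obtain ⟨⟨θ, hθ, hmax⟩, hnear⟩ :=
    maximizers_near_of_sphere W (kappa_nonneg G P) h₀ hε (hball hd)
  simp only [Set.mem_ofPred_eq, rbcml, cll_eq_logLik]
  exact ⟨⟨θ, hθ, hmax⟩, fun φ hφ i =>
    (dist_le_pi_dist φ θ₀ i).trans_lt (hnear φ hφ.1 hφ.2)⟩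

/-! ### Necessity: connectedness and stationarity -/

lemma logLik_add_const (W : CMLWeight m) (K : Fin m → Fin m → ℝ) (θ : Fin m → ℝ) (c : ℝ) :
    logLik W K (fun i => θ i + c) = logLik W K θ := by
  simp only [logLik, add_sub_add_right_eq_sub]

lemma plProb_add_const (θ : Fin m → ℝ) (c : ℝ) (R : Ranking m) :
    plProb (fun i => θ i + c) R = plProb θ R := by
  refine prod_congr rfl fun t _ => ?_
  simp only [Real.exp_add, ← sum_mul]
  exact mul_div_mul_right _ _ (Real.exp_ne_zero c)

lemma meanKappa_add_const (θ : Fin m → ℝ) (c : ℝ) (G : Breaking m) :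
    meanKappa (fun i => θ i + c) G = meanKappa θ G := by
  funext i j
  simp only [meanKappa, plProb_add_const]

lemma exists_add_const_mem_paramSpace (θ : Fin m → ℝ) :
    ∃ c : ℝ, (fun i => θ i + c) ∈ paramSpace m := by
  rcases Nat.eq_zero_or_pos m with rfl | hm
  · exact ⟨0, fun i => i.elim0⟩
  · refine ⟨-θ ⟨m - 1, by omega⟩, fun i hi => ?_⟩
    have : i = ⟨m - 1, by omega⟩ := by ext; simp only; omega
    simp [this]

/-- The objective sees only differences across edges of `W`, so a component without the last
alternative can be translated freely inside the parameter space. -/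
lemma isConnected_of_isConsistent {G : Breaking m} {W : CMLWeight m} (hG : G.Nonempty)
    (h : IsConsistent G W) : W.IsConnected := by
  obtain ⟨k, -, -⟩ := hG
  have hk := k.isLt
  set S := SimpleGraph.fromRel fun i j => 0 < W.weight i j with hS
  set last : Fin m := ⟨m - 1, by omega⟩ with hlast
  suffices hr : ∀ u, S.Reachable u last from
    { preconnected := fun u v => (hr u).trans (hr v).symm
      nonempty := ⟨k⟩ }
  classical
  intro u
  by_contra hu
  have hev := (h 0 (fun _ _ => rfl) 1 one_pos).eventually_const_lt (zero_lt_one)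
  obtain ⟨n, hn⟩ := hev.exists
  obtain ⟨P, ⟨θ, hθ⟩, hP⟩ : Set.Nonempty {P : Profile m n |
      (rbcml G W P).Nonempty ∧ ∀ θ ∈ rbcml G W P, ∀ i, |θ i - (0 : Fin m → ℝ) i| < 1} := by
    by_contra hne
    rw [Set.not_nonempty_iff_eq_empty] at hne
    rw [hne] at hn
    simp [profileProb] at hn
  -- A shift by `2` cannot keep both maximizers within `1` of the truth `0`.
  set φ : Fin m → ℝ := fun i => θ i + if S.Reachable u i then 2 else 0 with hφ
  have hval : cll G W P φ = cll G W P θ := by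
    rw [cll_eq_logLik]
    refine sum_congr rfl fun i _ => sum_congr rfl fun j hj => ?_
    have hij : i ≠ j := by simpa using hj
    rcases (W.nonneg i j).eq_or_lt with h0 | hpos
    · simp [← h0]
    · have hadj : S.Adj i j := by rw [hS, SimpleGraph.fromRel_adj]; exact ⟨hij, Or.inl hpos⟩
      have : S.Reachable u i ↔ S.Reachable u j :=
        ⟨fun h => h.trans hadj.reachable, fun h => h.trans hadj.symm.reachable⟩
      simp only [hφ, this, add_sub_add_right_eq_sub]
  have hmem : φ ∈ rbcml G W P := by
    refine ⟨fun i hi => ?_, fun ψ hψ => ?_⟩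
    · have : i = last := by ext; simp only [hlast]; omega
      subst this
      simp only [hφ, hu, if_false, add_zero]
      exact hθ.1 _ hi
    · change cll G W P ψ ≤ cll G W P φ
      rw [hval]
      exact hθ.2 hψ
  have h1 := abs_lt.1 (hP θ hθ u)
  have h2 := abs_lt.1 (hP φ hmem u)
  simp only [hφ, SimpleGraph.Reachable.refl, if_true, Pi.zero_apply] at h1 h2
  linarith

/-- The truth maximizes the expected composite log-likelihood of a consistent method. -/
lemma logLik_le_of_isConsistent {G : Breaking m} {W : CMLWeight m} (h : IsConsistent G W)
    (θ φ : Fin m → ℝ) : logLik W (meanKappa θ G) φ ≤ logLik W (meanKappa θ G) θ := by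
  suffices key : ∀ θ ∈ paramSpace m, ∀ φ ∈ paramSpace m,
      logLik W (meanKappa θ G) φ ≤ logLik W (meanKappa θ G) θ by
    obtain ⟨a, ha⟩ := exists_add_const_mem_paramSpace θ
    obtain ⟨b, hb⟩ := exists_add_const_mem_paramSpace φ
    simpa only [logLik_add_const, meanKappa_add_const] using key _ ha _ hb
  intro θ hθ φ hφ
  by_contra! hlt
  have hnear : ∀ᶠ z in 𝓝 (meanKappa θ G, θ), logLik W z.1 z.2 < logLik W z.1 φ :=
    ContinuousAt.eventually_lt (continuous_logLik W).continuousAt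
      ((continuous_logLik W).comp (by fun_prop :
        Continuous fun z : (Fin m → Fin m → ℝ) × (Fin m → ℝ) => (z.1, φ))).continuousAt hlt
  obtain ⟨δ, hδ, hball⟩ := Metric.eventually_nhds_iff.1 hnear
  have e1 := (h θ hθ δ hδ).eventually_const_lt (by norm_num : (1 / 2 : ℝ) < 1)
  have e2 := (tendsto_profileProb_kappa θ G hδ).eventually_const_lt (by norm_num : (1 / 2 : ℝ) < 1)
  -- Two events of probability above one half share a profile, whose weights and maximizer are then
  -- both `δ`-close to the limit.
  obtain ⟨n, h1, h2⟩ := (e1.and e2).exists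
  obtain ⟨P, ⟨⟨ψ, hψ⟩, hP⟩, hκ⟩ : Set.Nonempty ({P : Profile m n | (rbcml G W P).Nonempty ∧
      ∀ ψ ∈ rbcml G W P, ∀ i, |ψ i - θ i| < δ} ∩
      {P : Profile m n | ∀ i j, |kappa G P i j - meanKappa θ G i j| < δ}) := by
    by_contra hne
    have hdisj := Set.disjoint_iff_inter_eq_empty.2 (Set.not_nonempty_iff_eq_empty.1 hne)
    have := profileProb_mono θ hdisj.subset_compl_left
    linarith [profileProb_add_compl θ {P : Profile m n | (rbcml G W P).Nonempty ∧
      ∀ ψ ∈ rbcml G W P, ∀ i, |ψ i - θ i| < δ}]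
  have hd : dist (kappa G P, ψ) (meanKappa θ G, θ) < δ := by
    rw [Prod.dist_eq]
    exact max_lt
      ((dist_pi_lt_iff hδ).2 fun i => (dist_pi_lt_iff hδ).2 fun j => hκ i j)
      ((dist_pi_lt_iff hδ).2 fun i => hP ψ hψ i)
  have h3 : cll G W P φ ≤ cll G W P ψ := hψ.2 hφ
  rw [cll_eq_logLik] at h3
  exact absurd (hball hd) (not_lt.2 h3)

/-- The vanishing partial derivative in the direction `a`, with the terms of `(a, j)` and `(j, a)`
put together. -/
lemma stationarity_of_isMax (W : CMLWeight m) (K : Fin m → Fin m → ℝ) (θ : Fin m → ℝ)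
    (h : ∀ φ, logLik W K φ ≤ logLik W K θ) (a : Fin m) :
    ∑ j ∈ univ.filter (fun j => a ≠ j),
      (K a j * W.weight a j * Real.exp (θ j) - K j a * W.weight j a * Real.exp (θ a)) /
        (Real.exp (θ a) + Real.exp (θ j)) = 0 := by
  classical
  set e : Fin m → ℝ := Pi.single a 1 with he
  have hder : HasDerivAt (fun s : ℝ => logLik W K (fun i => θ i + s * e i))
      (∑ i, ∑ j ∈ univ.filter (fun j => i ≠ j), K i j * W.weight i j *
        -(Real.exp (θ j - θ i) * (e j - e i) / (1 + Real.exp (θ j - θ i)))) 0 := by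
    unfold logLik
    refine HasDerivAt.fun_sum fun i _ => HasDerivAt.fun_sum fun j _ => ?_
    refine HasDerivAt.const_mul _ (HasDerivAt.neg ?_)
    have h1 : HasDerivAt (fun s : ℝ => θ j + s * e j - (θ i + s * e i)) (e j - e i) 0 := by
      have := (((hasDerivAt_id (0 : ℝ)).mul_const (e j)).const_add (θ j)).fun_sub
        (((hasDerivAt_id (0 : ℝ)).mul_const (e i)).const_add (θ i))
      simpa using this
    have := (h1.exp.const_add 1).log (by positivity)
    simpa using this
  have hmax : IsLocalMax (fun s : ℝ => logLik W K (fun i => θ i + s * e i)) 0 := by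
    refine Eventually.of_forall fun s => ?_
    simpa using h (fun i => θ i + s * e i)
  have h0 := hmax.hasDerivAt_eq_zero hder
  -- Row `a` depends on `θ a` in all its terms, any other row only through its entry `j = a`.
  have hrow : ∀ i, ∑ j ∈ univ.filter (fun j => i ≠ j), K i j * W.weight i j *
        -(Real.exp (θ j - θ i) * (e j - e i) / (1 + Real.exp (θ j - θ i))) =
      (if i = a then ∑ j ∈ univ.filter (fun j => a ≠ j),
        K a j * W.weight a j * Real.exp (θ j) / (Real.exp (θ a) + Real.exp (θ j)) else 0) -
      (if a ≠ i then K i a * W.weight i a * Real.exp (θ a) /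
        (Real.exp (θ a) + Real.exp (θ i)) else 0) := by
    intro i
    by_cases hi : i = a
    · subst hi
      simp only [if_true, ne_eq, not_true_eq_false, if_false, sub_zero]
      refine sum_congr rfl fun j hj => ?_
      have hj : i ≠ j := by simpa using hj
      have e1 : e j = 0 := by simp [he, hj.symm]
      have e2 : e i = 1 := by simp [he]
      rw [e1, e2, Real.exp_sub]
      have := Real.exp_pos (θ i)
      have := Real.exp_pos (θ j)
      field_simp
      ring
    · rw [if_neg hi, if_pos (Ne.symm hi), sum_eq_single a]
      · have e1 : e i = 0 := by simp [he, hi]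
        have e2 : e a = 1 := by simp [he]
        rw [e1, e2, Real.exp_sub]
        have := Real.exp_pos (θ i)
        have := Real.exp_pos (θ a)
        field_simp
        ring
      · intro j _ hj
        have e1 : e i = 0 := by simp [he, hi]
        have e2 : e j = 0 := by simp [he, hj]
        simp [e1, e2]
      · simp [hi]
  rw [sum_congr rfl fun i _ => hrow i, sum_sub_distrib] at h0
  simp only [sum_ite_eq', mem_univ, if_true] at h0
  rw [← sum_filter, ← sum_sub_distrib] at h0
  rw [← h0]
  exact sum_congr rfl fun j _ => sub_div _ _ _

/-! ### Bounds and exchange formulas for ranking probabilities -/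

section Ratios

variable (θ : Fin m → ℝ)

lemma plProb_congr {R R' : Ranking m} (h : ∀ s, θ (R s) = θ (R' s)) :
    plProb θ R = plProb θ R' := by
  simp only [plProb, h]

lemma exp_le_tailSum (R : Ranking m) {s l : Fin m} (h : s ≤ l) :
    Real.exp (θ (R l)) ≤ tailSum θ R s :=
  single_le_sum (f := fun l => Real.exp (θ (R l))) (fun _ _ => (Real.exp_pos _).le)
    (mem_Ici.2 h)

lemma factor_le_one (R : Ranking m) (s : Fin m) : Real.exp (θ (R s)) / tailSum θ R s ≤ 1 :=
  (div_le_one (tailSum_pos θ R s)).2 (exp_le_tailSum θ R le_rfl)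

lemma factor_pos (R : Ranking m) (s : Fin m) : 0 < Real.exp (θ (R s)) / tailSum θ R s :=
  div_pos (Real.exp_pos _) (tailSum_pos θ R s)

lemma plProb_le_one (R : Ranking m) : plProb θ R ≤ 1 :=
  prod_le_one (fun s _ => (factor_pos θ R s).le) fun s _ => factor_le_one θ R s

lemma factor_le_div (R : Ranking m) {s l : Fin m} (h : s ≤ l) :
    Real.exp (θ (R s)) / tailSum θ R s ≤ Real.exp (θ (R s)) / Real.exp (θ (R l)) :=
  div_le_div_of_nonneg_left (Real.exp_pos _).le (Real.exp_pos _) (exp_le_tailSum θ R h)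

/-- All factors are at most `1`, and the tail sum at `s` contains the weight at `l`. A heavy
alternative placed below a light one therefore makes the ranking improbable. -/
lemma plProb_le_div (R : Ranking m) {s l : Fin m} (h : s ≤ l) :
    plProb θ R ≤ Real.exp (θ (R s)) / Real.exp (θ (R l)) := by
  refine le_trans ?_ (factor_le_div θ R h)
  rw [plProb_eq, ← mul_prod_erase univ _ (mem_univ s)]
  exact mul_le_of_le_one_right (factor_pos θ R s).le
    (prod_le_one (fun s _ => (factor_pos θ R s).le) fun s _ => factor_le_one θ R s)

lemma plProb_le_div_mul_div (R : Ranking m) {s l s' l' : Fin m} (hs : s ≠ s') (h : s ≤ l)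
    (h' : s' ≤ l') :
    plProb θ R ≤ (Real.exp (θ (R s)) / Real.exp (θ (R l))) *
      (Real.exp (θ (R s')) / Real.exp (θ (R l'))) := by
  refine le_trans ?_ (mul_le_mul (factor_le_div θ R h) (factor_le_div θ R h')
    (factor_pos θ R s').le (by positivity))
  rw [plProb_eq, ← mul_prod_erase univ _ (mem_univ s),
    ← mul_prod_erase (univ.erase s) _ (mem_erase.2 ⟨hs.symm, mem_univ s'⟩)]
  refine mul_le_mul_of_nonneg_left ?_ (factor_pos θ R s).le
  exact mul_le_of_le_one_right (factor_pos θ R s').le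
    (prod_le_one (fun s _ => (factor_pos θ R s).le) fun s _ => factor_le_one θ R s)

/-- At each position the heaviest remaining alternative is chosen, with chance at least `1 / m`. -/
lemma le_plProb_of_antitone (R : Ranking m) (h : Antitone fun s => θ (R s)) :
    ((m : ℝ) ^ m)⁻¹ ≤ plProb θ R := by
  have : ((m : ℝ) ^ m)⁻¹ = ∏ _s : Fin m, (m : ℝ)⁻¹ := by simp
  rw [this]
  refine prod_le_prod (fun _ _ => by positivity) fun s _ => ?_
  have hm : (0 : ℝ) < m := Nat.cast_pos.2 s.pos
  change _ ≤ _ / tailSum θ R s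
  rw [inv_eq_one_div, div_le_div_iff₀ hm (tailSum_pos θ R s), one_mul, tailSum]
  calc ∑ l ∈ Ici s, Real.exp (θ (R l)) ≤ ∑ l ∈ Ici s, Real.exp (θ (R s)) :=
        sum_le_sum fun l hl => Real.exp_le_exp.2 (h (mem_Ici.1 hl))
    _ ≤ ∑ l : Fin m, Real.exp (θ (R s)) :=
        sum_le_sum_of_subset_of_nonneg (subset_univ _) fun _ _ _ => (Real.exp_pos _).le
    _ = _ := by simp [mul_comm]

lemma tailSum_eq_add (R : Ranking m) {k k' : Fin m} (hk : (k' : ℕ) = k + 1) :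
    tailSum θ R k = Real.exp (θ (R k)) + tailSum θ R k' := by
  have : Ici k = insert k (Ici k') := by
    ext s; simp only [mem_Ici, mem_insert, Fin.le_def, Fin.ext_iff]; omega
  rw [tailSum, this, sum_insert (by simp [Fin.le_def, hk]), tailSum]

/-- Exchanging two neighbours changes the probability of a ranking by a simple factor. -/
lemma plProb_mul_swap (R : Ranking m) {k k' : Fin m} (hk : (k' : ℕ) = k + 1) :
    plProb θ (R * Equiv.swap k k') * (tailSum θ R k - Real.exp (θ (R k'))) =
      plProb θ R * (tailSum θ R k - Real.exp (θ (R k))) := by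
  have hne : k ≠ k' := by rintro rfl; omega
  have hle : k ≤ k' := Fin.le_def.2 (by omega)
  have h1 := tailSum_eq_add θ R hk
  have h2 := tailSum_eq_add θ (R * Equiv.swap k k') hk
  rw [tailSum_mul_swap θ R le_rfl hle, Equiv.Perm.mul_apply, Equiv.swap_apply_left] at h2
  have split : ∀ f : Fin m → ℝ, ∏ s, f s = f k * (f k' * ∏ s ∈ (univ.erase k).erase k', f s) :=
    fun f => by
      rw [mul_prod_erase _ _ (mem_erase.2 ⟨hne.symm, mem_univ k'⟩),
        mul_prod_erase _ _ (mem_univ k)]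
  have rest : ∏ s ∈ (univ.erase k).erase k', Real.exp (θ ((R * Equiv.swap k k') s)) /
      tailSum θ (R * Equiv.swap k k') s =
      ∏ s ∈ (univ.erase k).erase k', Real.exp (θ (R s)) / tailSum θ R s := by
    refine prod_congr rfl fun s hs => ?_
    simp only [mem_erase, mem_univ, and_true] at hs
    rw [Equiv.Perm.mul_apply, Equiv.swap_apply_of_ne_of_ne hs.2 hs.1]
    congr 1
    rcases lt_or_gt_of_ne hs.2 with h | h
    · exact tailSum_mul_swap θ R h.le (h.le.trans hle)
    · refine sum_congr rfl fun l hl => ?_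
      have hl := mem_Ici.1 hl
      have h' : k' < s := lt_of_le_of_ne (Fin.le_def.2 (by have := Fin.lt_def.1 h; omega)) hs.1.symm
      rw [Equiv.Perm.mul_apply, Equiv.swap_apply_of_ne_of_ne (h.trans_le hl).ne'
        (h'.trans_le hl).ne']
  rw [plProb_eq, plProb_eq, split, split, rest, tailSum_mul_swap θ R le_rfl hle,
    Equiv.Perm.mul_apply, Equiv.Perm.mul_apply, Equiv.swap_apply_left, Equiv.swap_apply_right]
  have e1 : tailSum θ R k - Real.exp (θ (R k')) = tailSum θ (R * Equiv.swap k k') k' := by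
    linarith
  have e2 : tailSum θ R k - Real.exp (θ (R k)) = tailSum θ R k' := by linarith
  rw [e1, e2]
  have := (tailSum_pos θ R k').ne'
  have := (tailSum_pos θ (R * Equiv.swap k k') k').ne'
  field_simp

end Ratios

/-! ### Asymptotics along parameters of separated magnitude -/

section Levels

/-- The order of magnitude assigned to a position: the positions before `k` come far above `k`,
which comes above the next `r` positions, which come above the rest. -/
def levelAt (k : Fin m) (r : ℕ) (s : Fin m) : ℕ :=
  -- The level of `k` differs by two from levels `4` and `0`, so comparisons of `R₀ k` with those
  -- alternatives contribute only `O(1 / t ^ 2)`; the gap of one isolates the next `r` positions at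
  -- order `1 / t`.
  if s < k then 4 else if s = k then 2 else if (s : ℕ) ≤ k + r then 1 else 0

/-- The order of magnitude of the alternative `j`, relative to the reference ranking `R₀`. -/
def level (R₀ : Ranking m) (k : Fin m) (r : ℕ) (j : Fin m) : ℕ := levelAt k r (R₀.symm j)

/-- The parameter for which the weight of `j` is `t ^ level j`. -/
noncomputable def levelParam (R₀ : Ranking m) (k : Fin m) (r : ℕ) (t : ℝ) (j : Fin m) : ℝ :=
  level R₀ k r j * Real.log t

/-- The ranking `R` has the same levels at all positions as the reference ranking. -/
def LevelSorted (R₀ : Ranking m) (k : Fin m) (r : ℕ) (R : Ranking m) : Prop :=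
  ∀ s, level R₀ k r (R s) = levelAt k r s

variable {R₀ : Ranking m} {k : Fin m} {r : ℕ}

lemma levelAt_antitone (k : Fin m) (r : ℕ) : Antitone (levelAt k r) := by
  intro s l h
  have h := Fin.le_def.1 h
  unfold levelAt
  simp only [Fin.lt_def, Fin.ext_iff]
  split_ifs <;> omega

lemma levelAt_eq_two {s : Fin m} : levelAt k r s = 2 ↔ s = k := by
  unfold levelAt
  simp only [Fin.lt_def, Fin.ext_iff]
  split_ifs <;> simp <;> omega

lemma levelAt_eq_one {s : Fin m} : levelAt k r s = 1 ↔ (k : ℕ) < s ∧ (s : ℕ) ≤ k + r := by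
  unfold levelAt
  simp only [Fin.lt_def, Fin.ext_iff]
  split_ifs <;> simp <;> omega

lemma levelAt_cases (s : Fin m) : levelAt k r s = 0 ∨ levelAt k r s = 1 ∨ levelAt k r s = 2 ∨
    levelAt k r s = 4 := by
  unfold levelAt
  split_ifs <;> simp

lemma level_eq_two {j : Fin m} : level R₀ k r j = 2 ↔ j = R₀ k := by
  rw [level, levelAt_eq_two, Equiv.symm_apply_eq]

lemma levelSorted_self : LevelSorted R₀ k r R₀ := fun s => by simp [level]

/-- Two sorted arrangements of the same multiset of levels coincide; levels are negated to fit
`Tuple.unique_monotone`. -/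
lemma levelSorted_of_antitone {R : Ranking m} (h : Antitone fun s => level R₀ k r (R s)) :
    LevelSorted R₀ k r R := by
  have h1 : Monotone ((fun j => -(level R₀ k r j : ℤ)) ∘ R) := fun a b hab => by
    have := h hab
    simpa using this
  have h2 : Monotone ((fun j => -(level R₀ k r j : ℤ)) ∘ R₀) := fun a b hab => by
    have := levelAt_antitone k r hab
    simpa [level] using this
  intro s
  have := congrFun (Tuple.unique_monotone h1 h2) s
  simpa [level] using this

lemma LevelSorted.apply_eq {R : Ranking m} (h : LevelSorted R₀ k r R) : R k = R₀ k :=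
  level_eq_two.1 ((h k).trans (levelAt_eq_two.2 rfl))

/-- A ranking that puts a level-one alternative above `R₀ k` has two inversions of the levels, or a
large one, or is a sorted ranking with the positions `k` and `k + 1` exchanged. -/
lemma levelSorted_mul_swap_of_few_inversions {R : Ranking m} {k' : Fin m} (hk : (k' : ℕ) = k + 1)
    {s l : Fin m} (hsl : s < l) (hs : level R₀ k r (R s) = 1) (hl : R l = R₀ k)
    (h1 : ∀ u v, u < v → level R₀ k r (R v) ≤ level R₀ k r (R u) + 1)
    (h2 : ∀ u v, u < v → u ≠ s → level R₀ k r (R v) ≤ level R₀ k r (R u)) :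
    s = k ∧ LevelSorted R₀ k r (R * Equiv.swap k k') := by
  have hl2 : level R₀ k r (R l) = 2 := level_eq_two.2 hl
  -- An alternative strictly between would have level at most `2` by `h1` and at least `2` by `h2`,
  -- so it would be `R₀ k` itself.
  have hadj : (l : ℕ) = s + 1 := by
    by_contra hne
    have hlt := Fin.lt_def.1 hsl
    have hlm := l.isLt
    set u : Fin m := ⟨s + 1, by omega⟩ with hu
    have hsu : s < u := Fin.lt_def.2 (by simp [hu])
    have hul : u < l := Fin.lt_def.2 (by simp only [hu]; omega)
    have a1 := h1 s u hsu
    have a2 := h2 u l hul hsu.ne'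
    have : level R₀ k r (R u) = 2 := by omega
    have := R.injective ((level_eq_two.1 this).trans hl.symm)
    exact hul.ne this
  have hsort : LevelSorted R₀ k r (R * Equiv.swap s l) := by
    refine levelSorted_of_antitone fun u v huv => ?_
    rcases huv.eq_or_lt with rfl | huv
    · exact le_rfl
    simp only [Equiv.Perm.mul_apply]
    have huv' := Fin.lt_def.1 huv
    by_cases us : u = s
    · subst us
      rw [Equiv.swap_apply_left]
      by_cases vl : v = l
      · subst vl; rw [Equiv.swap_apply_right]; omega
      · rw [Equiv.swap_apply_of_ne_of_ne huv.ne' vl]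
        exact h2 l v (Fin.lt_def.2 (by have := Fin.val_ne_of_ne vl; omega)) hsl.ne'
    by_cases ul : u = l
    · subst ul
      have vs : v ≠ s := (hsl.trans huv).ne'
      rw [Equiv.swap_apply_right, Equiv.swap_apply_of_ne_of_ne vs huv.ne', hs]
      have a := h2 u v huv us
      have : level R₀ k r (R v) ≠ 2 := fun h =>
        huv.ne' (R.injective ((level_eq_two.1 h).trans hl.symm))
      omega
    rw [Equiv.swap_apply_of_ne_of_ne us ul]
    by_cases vs : v = s
    · subst vs
      rw [Equiv.swap_apply_left]
      exact h2 u l (huv.trans hsl) us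
    by_cases vl : v = l
    · subst vl
      rw [Equiv.swap_apply_right]
      exact h2 u s (Fin.lt_def.2 (by have := Fin.val_ne_of_ne us; omega)) us
    · rw [Equiv.swap_apply_of_ne_of_ne vs vl]
      exact h2 u v huv us
  have hsk : s = k := by
    have := hsort s
    rw [Equiv.Perm.mul_apply, Equiv.swap_apply_left, hl2] at this
    exact levelAt_eq_two.1 this.symm
  subst hsk
  have : l = k' := Fin.ext (by omega)
  subst this
  exact ⟨rfl, hsort⟩

lemma exp_levelParam {t : ℝ} (ht : 0 < t) (j : Fin m) :
    Real.exp (levelParam R₀ k r t j) = t ^ level R₀ k r j := by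
  rw [levelParam, Real.exp_nat_mul, Real.exp_log ht]

lemma plProb_levelSorted {R : Ranking m} (h : LevelSorted R₀ k r R) (t : ℝ) :
    plProb (levelParam R₀ k r t) R = plProb (levelParam R₀ k r t) R₀ :=
  plProb_congr _ fun s => by rw [levelParam, levelParam, h s, levelSorted_self s]

lemma le_plProb_self {t : ℝ} (ht : 1 ≤ t) :
    ((m : ℝ) ^ m)⁻¹ ≤ plProb (levelParam R₀ k r t) R₀ := by
  refine le_plProb_of_antitone _ _ fun a b hab => ?_
  have := levelAt_antitone k r hab
  simp only [levelParam, levelSorted_self _]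
  exact mul_le_mul_of_nonneg_right (by exact_mod_cast this) (Real.log_nonneg ht)

lemma pow_div_pow_le {t : ℝ} (ht : 1 ≤ t) {a b d : ℕ} (h : a + d ≤ b) :
    t ^ a / t ^ b ≤ 1 / t ^ d := by
  have : 0 < t := by linarith
  rw [div_le_div_iff₀ (by positivity) (by positivity), ← pow_add, one_mul]
  exact pow_le_pow_right₀ ht h

/-- The probability of a ranking relative to the reference ranking. -/
noncomputable def relProb (R₀ : Ranking m) (k : Fin m) (r : ℕ) (R : Ranking m) (t : ℝ) : ℝ :=
  plProb (levelParam R₀ k r t) R / plProb (levelParam R₀ k r t) R₀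

/-- The reference ranking is sorted, so its probability stays above `m ^ (-m)` and division by it
does no harm. -/
lemma tendsto_mul_relProb_zero {R : Ranking m} {a : ℝ → ℝ} (ha : ∀ t, 1 ≤ t → 0 ≤ a t)
    (h : ∀ t, 1 ≤ t → a t * plProb (levelParam R₀ k r t) R ≤ 1 / t) :
    Tendsto (fun t => a t * relProb R₀ k r R t) atTop (𝓝 0) := by
  have hlim : Tendsto (fun t : ℝ => (m : ℝ) ^ m / t) atTop (𝓝 0) :=
    tendsto_const_nhds.div_atTop tendsto_id
  refine squeeze_zero' ?_ ?_ hlim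
  · filter_upwards [eventually_ge_atTop 1] with t ht
    exact mul_nonneg (ha t ht) (div_pos (plProb_pos _ _) (plProb_pos _ _)).le
  · filter_upwards [eventually_ge_atTop 1] with t ht
    have hm : (0 : ℝ) < (m : ℝ) ^ m := pow_pos (Nat.cast_pos.2 k.pos) _
    have h0 := le_plProb_self (R₀ := R₀) (k := k) (r := r) ht
    rw [relProb, ← mul_div_assoc, div_le_iff₀ (plProb_pos _ _)]
    have htpos : 0 < t := by linarith
    calc _ ≤ 1 / t := h t ht
      _ = (m : ℝ) ^ m / t * ((m : ℝ) ^ m)⁻¹ := by field_simp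
      _ ≤ _ := mul_le_mul_of_nonneg_left h0 (by positivity)

/-- For `j` of level one the logistic factor is of order `1 / t`, and any level inversion costs
another `1 / t`. Level zero loses `1 / t ^ 2` in the factor, level four in the probability. -/
lemma tendsto_above {R : Ranking m} {j : Fin m} (hj : j ≠ R₀ k)
    (hR : R.symm (R₀ k) < R.symm j) [Decidable (level R₀ k r j = 1 ∧ LevelSorted R₀ k r R)] :
    Tendsto (fun t : ℝ => t * (t ^ level R₀ k r j / (t ^ 2 + t ^ level R₀ k r j)) *
      relProb R₀ k r R t) atTop
      (𝓝 (if level R₀ k r j = 1 ∧ LevelSorted R₀ k r R then 1 else 0)) := by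
  have h2 : level R₀ k r j ≠ 2 := fun h => hj (level_eq_two.1 h)
  have hnn : ∀ t : ℝ, 1 ≤ t → 0 ≤ t * (t ^ level R₀ k r j / (t ^ 2 + t ^ level R₀ k r j)) :=
    fun t ht => by have : 0 < t := by linarith
                   positivity
  rcases levelAt_cases (k := k) (r := r) (R₀.symm j) with h | h | h | h
  · change level R₀ k r j = 0 at h
    rw [if_neg (by omega)]
    refine tendsto_mul_relProb_zero hnn fun t ht => ?_
    have htpos : 0 < t := by linarith
    refine (mul_le_of_le_one_right (hnn t ht) (plProb_le_one _ _)).trans ?_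
    rw [h, pow_zero, ← mul_div_assoc, div_le_div_iff₀ (by positivity) htpos]
    nlinarith
  · change level R₀ k r j = 1 at h
    by_cases hs : LevelSorted R₀ k r R
    · rw [if_pos ⟨h, hs⟩]
      have hlim : Tendsto (fun t : ℝ => 1 - 1 / (t + 1)) atTop (𝓝 1) := by
        simpa using (tendsto_const_nhds.div_atTop
          (tendsto_atTop_add_const_right atTop (1 : ℝ) tendsto_id) :
          Tendsto (fun t : ℝ => (1 : ℝ) / (t + 1)) atTop (𝓝 0)).const_sub 1
      refine hlim.congr' ?_
      filter_upwards [eventually_gt_atTop 0] with t ht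
      rw [relProb, plProb_levelSorted hs, div_self (plProb_pos _ _).ne', h]
      field_simp
      ring
    · rw [if_neg (by tauto)]
      refine tendsto_mul_relProb_zero hnn fun t ht => ?_
      have htpos : 0 < t := by linarith
      obtain ⟨u, v, huv, hlt⟩ : ∃ u v, u ≤ v ∧ level R₀ k r (R u) < level R₀ k r (R v) := by
        by_contra! hcon
        exact hs (levelSorted_of_antitone fun u v huv => hcon u v huv)
      have hp := plProb_le_div (levelParam R₀ k r t) R huv
      rw [exp_levelParam htpos, exp_levelParam htpos] at hp
      have hp := hp.trans (pow_div_pow_le ht (d := 1) hlt)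
      rw [pow_one] at hp
      refine (mul_le_of_le_one_left (plProb_pos _ _).le ?_).trans hp
      rw [h, ← mul_div_assoc, div_le_one (by positivity)]
      nlinarith
  · exact absurd h h2
  · change level R₀ k r j = 4 at h
    rw [if_neg (by omega)]
    refine tendsto_mul_relProb_zero hnn fun t ht => ?_
    have htpos : 0 < t := by linarith
    have hp := plProb_le_div (levelParam R₀ k r t) R hR.le
    rw [exp_levelParam htpos, exp_levelParam htpos, Equiv.apply_symm_apply,
      Equiv.apply_symm_apply, h, level_eq_two.2 rfl] at hp
    have hp := hp.trans (pow_div_pow_le ht (d := 2) (by norm_num))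
    calc _ ≤ t * 1 * (1 / t ^ 2) := by
          refine mul_le_mul (mul_le_mul_of_nonneg_left ?_ htpos.le) hp (plProb_pos _ _).le
            (by positivity)
          exact div_le_one_of_le₀ (by linarith [sq_nonneg t]) (by positivity)
      _ = 1 / t := by field_simp

lemma tailSum_levelParam {R : Ranking m} (h : LevelSorted R₀ k r R) (hr : (k : ℕ) + r < m) {t : ℝ}
    (ht : 0 < t) : tailSum (levelParam R₀ k r t) R k = t ^ 2 + r * t + (m - 1 - k - r : ℕ) := by
  have e1 : ∀ s, Real.exp (levelParam R₀ k r t (R s)) = t ^ levelAt k r s := fun s => by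
    rw [exp_levelParam ht, h s]
  set b : Fin m := ⟨k + r, hr⟩ with hb
  have hd : Ici k = insert k (Ioc k b ∪ Ioi b) := by
    ext s; simp only [mem_Ici, mem_insert, mem_union, mem_Ioc, mem_Ioi, Fin.le_def, Fin.lt_def,
      Fin.ext_iff, hb]; omega
  rw [tailSum, hd, sum_insert (by
      simp only [mem_union, mem_Ioc, mem_Ioi, Fin.lt_def, Fin.le_def, hb]; omega),
    sum_union (by
      rw [disjoint_left]; intro s h1 h2
      exact absurd (mem_Ioc.1 h1).2 (not_le.2 (mem_Ioi.1 h2)))]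
  have s1 : ∑ s ∈ Ioc k b, Real.exp (levelParam R₀ k r t (R s)) = r * t := by
    rw [sum_congr rfl (g := fun _ => t), sum_const, Fin.card_Ioc, nsmul_eq_mul]
    · simp [hb]
    · intro s hs
      have : levelAt k r s = 1 := levelAt_eq_one.2 (by
        simpa only [mem_Ioc, Fin.lt_def, Fin.le_def, hb] using hs)
      rw [e1, this, pow_one]
  have s2 : ∑ s ∈ Ioi b, Real.exp (levelParam R₀ k r t (R s)) = (m - 1 - k - r : ℕ) := by
    rw [sum_congr rfl (g := fun _ => 1), sum_const, Fin.card_Ioi, nsmul_eq_mul, mul_one]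
    · simp [hb, Nat.sub_sub, add_assoc]
    · intro s hs
      have hs := Fin.lt_def.1 (mem_Ioi.1 hs)
      simp only [hb] at hs
      have : levelAt k r s = 0 := by
        unfold levelAt
        simp only [Fin.lt_def, Fin.ext_iff]
        split_ifs <;> omega
      rw [e1, this, pow_zero]
  rw [s1, s2, e1, levelAt_eq_two.2 rfl]
  ring

/-- Now the logistic factor tends to `1` for `j` of level one, and the inversion of `j` and `R₀ k`
supplies the `1 / t`. A further or larger inversion is negligible, which leaves the sorted rankings
with `k` and `k'` exchanged. -/
lemma tendsto_below {R : Ranking m} {j k' : Fin m} (hk : (k' : ℕ) = k + 1)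
    (hr : (k : ℕ) + r < m) (hr1 : 1 ≤ r) (hj : j ≠ R₀ k)
    (hR : R.symm j < R.symm (R₀ k))
    [Decidable (R k = j ∧ LevelSorted R₀ k r (R * Equiv.swap k k'))] :
    Tendsto (fun t : ℝ => t * (t ^ 2 / (t ^ 2 + t ^ level R₀ k r j)) *
      relProb R₀ k r R t) atTop
      (𝓝 (if R k = j ∧ LevelSorted R₀ k r (R * Equiv.swap k k') then (r : ℝ) else 0)) := by
  have h2 : level R₀ k r j ≠ 2 := fun h => hj (level_eq_two.1 h)
  have hnn : ∀ t : ℝ, 1 ≤ t → 0 ≤ t * (t ^ 2 / (t ^ 2 + t ^ level R₀ k r j)) :=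
    fun t ht => by have : 0 < t := by linarith
                   positivity
  have hle : ∀ t : ℝ, 1 ≤ t → t * (t ^ 2 / (t ^ 2 + t ^ level R₀ k r j)) ≤ t :=
    fun t ht => by
      have : 0 < t := by linarith
      refine mul_le_of_le_one_right this.le (div_le_one_of_le₀ ?_ (by positivity))
      linarith [pow_pos this (level R₀ k r j)]
  have hsq : ∀ t : ℝ, 1 ≤ t → plProb (levelParam R₀ k r t) R ≤ 1 / t ^ 2 →
      t * (t ^ 2 / (t ^ 2 + t ^ level R₀ k r j)) * plProb (levelParam R₀ k r t) R ≤ 1 / t := by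
    intro t ht hp
    have : 0 < t := by linarith
    calc _ ≤ t * (1 / t ^ 2) := mul_le_mul (hle t ht) hp (plProb_pos _ _).le this.le
      _ = 1 / t := by field_simp
  have hlev : R k = j ∧ LevelSorted R₀ k r (R * Equiv.swap k k') → level R₀ k r j = 1 := by
    rintro ⟨rfl, hs⟩
    have := hs k'
    rw [Equiv.Perm.mul_apply, Equiv.swap_apply_right] at this
    rw [this]
    exact levelAt_eq_one.2 (by omega)
  by_cases hs : R k = j ∧ LevelSorted R₀ k r (R * Equiv.swap k k')
  · rw [if_pos hs]
    have h := hlev hs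
    obtain ⟨rfl, hs⟩ := hs
    set c : ℝ := ((m - 1 - k - r : ℕ) : ℝ) with hc
    have hlim : Tendsto (fun t : ℝ => (r + c / t) / ((1 + 1 / t) * (1 + (r - 1) / t + c / t / t)))
        atTop (𝓝 r) := by
      have z : ∀ c : ℝ, Tendsto (fun t : ℝ => c / t) atTop (𝓝 0) := fun c =>
        tendsto_const_nhds.div_atTop tendsto_id
      have z2 : Tendsto (fun t : ℝ => c / t / t) atTop (𝓝 0) := (z c).div_atTop tendsto_id
      have hnum := (z c).const_add (r : ℝ)
      have hden := ((z 1).const_add 1).mul ((((z (r - 1)).const_add 1)).add z2)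
      have h0 := hnum.div hden (by simp)
      simp only [add_zero, mul_one, div_one] at h0
      exact h0
    refine hlim.congr' ?_
    filter_upwards [eventually_ge_atTop 1] with t ht
    have htpos : 0 < t := by linarith
    -- The exchange formula gives the relative probability `(r t + c) / (t ^ 2 + (r - 1) t + c)`,
    -- with `c` the number of level-zero alternatives; hence the limit `r`.
    have hsw := plProb_mul_swap (levelParam R₀ k r t) (R * Equiv.swap k k') hk
    rw [mul_assoc, Equiv.swap_mul_self, mul_one, plProb_levelSorted hs,
      tailSum_levelParam hs hr htpos, exp_levelParam htpos, exp_levelParam htpos, hs, hs,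
      levelAt_eq_two.2 rfl, levelAt_eq_one.2 (by omega), pow_one] at hsw
    have hr' : (1 : ℝ) ≤ r := by exact_mod_cast hr1
    have hc0 : 0 ≤ c := Nat.cast_nonneg _
    have hden : 0 < t ^ 2 + (r - 1) * t + c := by
      have : 0 ≤ (r - 1 : ℝ) * t := mul_nonneg (by linarith) htpos.le
      positivity
    have hrel : relProb R₀ k r R t = (r * t + c) / (t ^ 2 + (r - 1) * t + c) := by
      rw [relProb, div_eq_div_iff (plProb_pos _ _).ne' hden.ne']
      linear_combination hsw
    rw [hrel, h, pow_one]
    have e : (1 + (r - 1) / t + c / t / t : ℝ) = (t ^ 2 + (r - 1) * t + c) / t ^ 2 := by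
      field_simp
    rw [e]
    field_simp
  · rw [if_neg hs]
    refine tendsto_mul_relProb_zero hnn fun t ht => ?_
    have htpos : 0 < t := by linarith
    rcases levelAt_cases (k := k) (r := r) (R₀.symm j) with h | h | h | h
    · change level R₀ k r j = 0 at h
      refine hsq t ht ?_
      have hp := plProb_le_div (levelParam R₀ k r t) R hR.le
      rw [exp_levelParam htpos, exp_levelParam htpos, Equiv.apply_symm_apply,
        Equiv.apply_symm_apply, h, level_eq_two.2 rfl] at hp
      exact hp.trans (pow_div_pow_le ht (d := 2) (by norm_num))
    · change level R₀ k r j = 1 at h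
      refine hsq t ht ?_
      by_cases h1 : ∀ u v, u < v → level R₀ k r (R v) ≤ level R₀ k r (R u) + 1
      -- Inversions are counted by their upper position: a second one starting elsewhere than at `j`
      -- multiplies the bound by another `1 / t`.
      · by_cases h2 : ∀ u v, u < v → u ≠ R.symm j → level R₀ k r (R v) ≤ level R₀ k r (R u)
        · have := levelSorted_mul_swap_of_few_inversions hk hR (by simpa using h) (by simp) h1 h2
          exact absurd ⟨by rw [← this.1]; simp, this.2⟩ hs
        · push Not at h2
          obtain ⟨u, v, huv, hne, hlt⟩ := h2
          have hp := plProb_le_div_mul_div (levelParam R₀ k r t) R hne huv.le hR.le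
          simp only [exp_levelParam htpos, Equiv.apply_symm_apply, h, level_eq_two.2] at hp
          refine hp.trans ?_
          calc _ ≤ 1 / t ^ 1 * (1 / t ^ 1) := mul_le_mul (pow_div_pow_le ht hlt)
                (pow_div_pow_le ht le_rfl) (by positivity) (by positivity)
            _ = _ := by field_simp
      · push Not at h1
        obtain ⟨u, v, huv, hlt⟩ := h1
        have hp := plProb_le_div (levelParam R₀ k r t) R huv.le
        rw [exp_levelParam htpos, exp_levelParam htpos] at hp
        exact hp.trans (pow_div_pow_le ht (d := 2) (by omega))
    · exact absurd h h2
    · change level R₀ k r j = 4 at h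
      refine (mul_le_of_le_one_right (hnn t ht) (plProb_le_one _ _)).trans ?_
      rw [h, ← mul_div_assoc, div_le_div_iff₀ (by positivity) htpos]
      nlinarith [pow_pos htpos 2]

end Levels

/-! ### Counting sorted rankings; the identity between the weights -/

section Identity

variable {R₀ : Ranking m} {k b : Fin m} {r : ℕ}

lemma levelAt_eq_one_iff_mem_Ioc (hb : (b : ℕ) = k + r) {s : Fin m} :
    levelAt k r s = 1 ↔ s ∈ Ioc k b := by
  rw [levelAt_eq_one, mem_Ioc, Fin.lt_def, Fin.le_def, hb]

lemma level_apply_eq_one (hb : (b : ℕ) = k + r) {s : Fin m} :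
    level R₀ k r (R₀ s) = 1 ↔ s ∈ Ioc k b := by
  rw [level, Equiv.symm_apply_apply, levelAt_eq_one_iff_mem_Ioc hb]

lemma sum_level_eq_one (hb : (b : ℕ) = k + r) (f : Fin m → ℝ) :
    ∑ j ∈ univ.filter (fun j => level R₀ k r j = 1), f j = ∑ s ∈ Ioc k b, f (R₀ s) := by
  refine (sum_equiv R₀ (fun s => ?_) fun s _ => rfl).symm
  rw [mem_filter, level_apply_eq_one hb]
  simp

lemma card_level_eq_one (hb : (b : ℕ) = k + r) :
    #(univ.filter (fun j => level R₀ k r j = 1)) = r := by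
  have : univ.filter (fun j => level R₀ k r j = 1) = (Ioc k b).map R₀.toEmbedding := by
    ext j
    simp only [mem_filter, mem_univ, true_and, mem_map_equiv, ← level_apply_eq_one (R₀ := R₀) hb,
      Equiv.apply_symm_apply]
  rw [this, card_map, Fin.card_Ioc]
  omega

open Classical in
/-- Every level-one alternative is equally often at a given level-one position. -/
lemma card_levelSorted (hb : (b : ℕ) = k + r) {j l : Fin m} (hj : level R₀ k r j = 1)
    (hl : l ∈ Ioc k b) :
    r * #(univ.filter fun R => LevelSorted R₀ k r R ∧ R l = j) =
      #(univ.filter fun R => LevelSorted R₀ k r R) := by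
  have hmaps : ∀ R ∈ univ.filter (fun R => LevelSorted R₀ k r R),
      R l ∈ univ.filter (fun j => level R₀ k r j = 1) := by
    intro R hR
    rw [mem_filter] at hR ⊢
    exact ⟨mem_univ _, by rw [hR.2 l]; exact (levelAt_eq_one_iff_mem_Ioc hb).2 hl⟩
  rw [card_eq_sum_card_fiberwise hmaps, sum_congr rfl
    (g := fun _ => #(univ.filter fun R => LevelSorted R₀ k r R ∧ R l = j)), sum_const,
    card_level_eq_one hb, smul_eq_mul]
  intro j' hj'
  have hj' : level R₀ k r j' = 1 := (mem_filter.1 hj').2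
  rw [filter_filter]
  -- Relabelling two alternatives of equal level preserves sortedness.
  refine card_equiv (Equiv.mulLeft (Equiv.swap j j')) fun R => ?_
  have hlev : ∀ x, level R₀ k r (Equiv.swap j j' x) = level R₀ k r x := by
    intro x
    by_cases h1 : x = j
    · rw [h1, Equiv.swap_apply_left, hj, hj']
    by_cases h2 : x = j'
    · rw [h2, Equiv.swap_apply_right, hj, hj']
    rw [Equiv.swap_apply_of_ne_of_ne h1 h2]
  have hsort : LevelSorted R₀ k r (Equiv.swap j j' * R) ↔ LevelSorted R₀ k r R := by
    simp only [LevelSorted, Equiv.Perm.mul_apply, hlev]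
  rw [mem_filter, mem_filter, Equiv.coe_mulLeft, hsort, Equiv.Perm.mul_apply,
    Equiv.swap_apply_eq_iff, Equiv.swap_apply_left]
  simp

open Classical in
-- Over the sorted rankings, the position of a level-one alternative is equidistributed on `Ioc k
-- b`.
lemma sum_levelSorted (hb : (b : ℕ) = k + r) {j : Fin m} (hj : level R₀ k r j = 1)
    (g : Fin m → ℝ) :
    r * ∑ R : Ranking m, (if LevelSorted R₀ k r R then g (R.symm j) else 0) =
      #(univ.filter fun R => LevelSorted R₀ k r R) * ∑ l ∈ Ioc k b, g l := by
  have hmaps : ∀ R ∈ univ.filter (fun R => LevelSorted R₀ k r R), R.symm j ∈ Ioc k b := by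
    intro R hR
    have := (mem_filter.1 hR).2 (R.symm j)
    rw [Equiv.apply_symm_apply, hj, eq_comm] at this
    exact (levelAt_eq_one_iff_mem_Ioc hb).1 this
  rw [← sum_filter, ← sum_fiberwise_of_maps_to hmaps, mul_sum, mul_sum]
  refine sum_congr rfl fun l hl => ?_
  rw [sum_congr rfl (g := fun _ => g l) (fun R hR => by rw [(mem_filter.1 hR).2]), sum_const,
    nsmul_eq_mul, ← card_levelSorted hb hj hl, filter_filter]
  simp only [Equiv.symm_apply_eq, eq_comm (a := j)]
  push_cast; ring

open Classical in
-- Undoing the exchange leaves the sorted rankings with `j` at `k'`, a fraction `1 / r` of all the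
-- sorted ones.
lemma sum_levelSorted_mul_swap (hb : (b : ℕ) = k + r) (hr : 1 ≤ r) {k' : Fin m}
    (hk : (k' : ℕ) = k + 1) {j : Fin m} (hj : level R₀ k r j = 1) :
    r * ∑ R : Ranking m,
      (if R k = j ∧ LevelSorted R₀ k r (R * Equiv.swap k k') then (1 : ℝ) else 0) =
      #(univ.filter fun R => LevelSorted R₀ k r R) := by
  have hl : k' ∈ Ioc k b := by
    simp only [mem_Ioc, Fin.lt_def, Fin.le_def]; omega
  rw [← card_levelSorted hb hj hl]
  push_cast
  congr 1
  rw [sum_boole]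
  congr 1
  refine card_equiv (Equiv.mulRight (Equiv.swap k k')) fun R => ?_
  simp [and_comm]

/-- The leading term of the stationarity conditions along `levelParam`. -/
lemma weight_identity {G : Breaking m} {W : CMLWeight m}
    (hst : ∀ (θ : Fin m → ℝ) (a : Fin m), ∑ j ∈ univ.filter (fun j => a ≠ j),
      (meanKappa θ G a j * W.weight a j * Real.exp (θ j) -
        meanKappa θ G j a * W.weight j a * Real.exp (θ a)) /
        (Real.exp (θ a) + Real.exp (θ j)) = 0)
    (R₀ : Ranking m) {k k' b : Fin m} {r : ℕ} (hk : (k' : ℕ) = k + 1) (hb : (b : ℕ) = k + r)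
    (hr : 1 ≤ r) :
    (∑ s ∈ Ioc k b, W.weight (R₀ k) (R₀ s)) * ∑ l ∈ Ioc k b, G.weight k l =
      r * G.weight k k' * ∑ s ∈ Ioc k b, W.weight (R₀ s) (R₀ k) := by
  classical
  set i := R₀ k with hi
  have hkr : (k : ℕ) + r < m := hb ▸ b.isLt
  have hzero : ∀ᶠ t : ℝ in atTop, ∑ j ∈ univ.filter (fun j => i ≠ j),
      (∑ R : Ranking m, W.weight i j * (G.extract R i j *
        (t * (t ^ level R₀ k r j / (t ^ 2 + t ^ level R₀ k r j)) * relProb R₀ k r R t)) -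
       ∑ R : Ranking m, W.weight j i * (G.extract R j i *
        (t * (t ^ 2 / (t ^ 2 + t ^ level R₀ k r j)) * relProb R₀ k r R t))) = 0 := by
    -- The stationarity equation at `i`, multiplied by `t` and divided by the probability of `R₀`.
    filter_upwards [eventually_gt_atTop 0] with t ht
    have := hst (levelParam R₀ k r t) i
    rw [← mul_zero (t / plProb (levelParam R₀ k r t) R₀), ← this, mul_sum]
    refine sum_congr rfl fun j _ => ?_
    have h2 : level R₀ k r i = 2 := level_eq_two.2 rfl
    rw [exp_levelParam ht, exp_levelParam ht, h2, meanKappa, meanKappa, sub_div, mul_sub]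
    congr 1
    · rw [sum_mul, sum_mul, sum_div, mul_sum]
      refine sum_congr rfl fun R _ => ?_
      rw [relProb]; ring
    · rw [sum_mul, sum_mul, sum_div, mul_sum]
      refine sum_congr rfl fun R _ => ?_
      rw [relProb]; ring
  have hlim : Tendsto (fun t : ℝ => ∑ j ∈ univ.filter (fun j => i ≠ j),
      (∑ R : Ranking m, W.weight i j * (G.extract R i j *
        (t * (t ^ level R₀ k r j / (t ^ 2 + t ^ level R₀ k r j)) * relProb R₀ k r R t)) -
       ∑ R : Ranking m, W.weight j i * (G.extract R j i *
        (t * (t ^ 2 / (t ^ 2 + t ^ level R₀ k r j)) * relProb R₀ k r R t)))) atTop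
      (𝓝 (∑ j ∈ univ.filter (fun j => i ≠ j),
      (∑ R : Ranking m, W.weight i j * (G.extract R i j *
        (if level R₀ k r j = 1 ∧ LevelSorted R₀ k r R then 1 else 0)) -
       ∑ R : Ranking m, W.weight j i * (G.extract R j i *
        (if R k = j ∧ LevelSorted R₀ k r (R * Equiv.swap k k') then (r : ℝ) else 0))))) := by
    refine tendsto_finsetSum _ fun j hj => Tendsto.sub (tendsto_finsetSum _ fun R _ => ?_)
      (tendsto_finsetSum _ fun R _ => ?_)
    · have hj : j ≠ i := by simpa [eq_comm] using hj
      by_cases h : R.symm i < R.symm j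
      · exact ((tendsto_above hj h).const_mul _).const_mul _
      · have : G.extract R i j = 0 := by simp [Breaking.extract, Ranking.Prefers, h]
        simp [this]
    · have hj : j ≠ i := by simpa [eq_comm] using hj
      by_cases h : R.symm j < R.symm i
      · exact ((tendsto_below hk hkr hr hj h).const_mul _).const_mul _
      · have : G.extract R j i = 0 := by simp [Breaking.extract, Ranking.Prefers, h]
        simp [this]
  have h0 := tendsto_nhds_unique (hlim.congr' hzero) tendsto_const_nhds
  set M : ℝ := (#(univ.filter fun R => LevelSorted R₀ k r R) : ℝ) with hM
  have hMpos : 0 < M :=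
    Nat.cast_pos.2 (card_pos.2 ⟨R₀, mem_filter.2 ⟨mem_univ _, levelSorted_self⟩⟩)
  -- After multiplication by `r`, both counts become multiples of the number `M` of sorted rankings,
  -- which cancels at the end.
  have hterm : ∀ j ∈ univ.filter (fun j => i ≠ j),
      (r : ℝ) * (∑ R : Ranking m, W.weight i j * (G.extract R i j *
        (if level R₀ k r j = 1 ∧ LevelSorted R₀ k r R then 1 else 0)) -
       ∑ R : Ranking m, W.weight j i * (G.extract R j i *
        (if R k = j ∧ LevelSorted R₀ k r (R * Equiv.swap k k') then (r : ℝ) else 0))) =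
      if level R₀ k r j = 1 then M * (W.weight i j * ∑ l ∈ Ioc k b, G.weight k l -
        r * G.weight k k' * W.weight j i) else 0 := by
    intro j hj
    have hj : i ≠ j := by simpa using hj
    by_cases hlev : level R₀ k r j = 1
    · rw [if_pos hlev, mul_sub]
      have e1 : ∑ R : Ranking m, W.weight i j * (G.extract R i j *
          (if level R₀ k r j = 1 ∧ LevelSorted R₀ k r R then 1 else 0)) =
          W.weight i j * ∑ R : Ranking m,
            (if LevelSorted R₀ k r R then G.weight k (R.symm j) else 0) := by
        rw [← mul_sum]
        congr 1
        refine sum_congr rfl fun R _ => ?_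
        by_cases hs : LevelSorted R₀ k r R
        · have hRi : R.symm i = k := by rw [Equiv.symm_apply_eq, hs.apply_eq]
          have hlt : k < R.symm j := by
            have := hs (R.symm j)
            rw [Equiv.apply_symm_apply, hlev, eq_comm, levelAt_eq_one] at this
            exact this.1
          simp [hlev, hs, Breaking.extract, Ranking.Prefers, hRi, hlt]
        · simp [hs]
      have e2 : ∑ R : Ranking m, W.weight j i * (G.extract R j i *
          (if R k = j ∧ LevelSorted R₀ k r (R * Equiv.swap k k') then (r : ℝ) else 0)) =
          r * G.weight k k' * W.weight j i * ∑ R : Ranking m,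
            (if R k = j ∧ LevelSorted R₀ k r (R * Equiv.swap k k') then (1 : ℝ) else 0) := by
        rw [mul_sum]
        refine sum_congr rfl fun R _ => ?_
        split_ifs with hs
        · have h1 : R.symm j = k := by rw [Equiv.symm_apply_eq, hs.1]
          have h2 : R.symm i = k' := by
            have := hs.2.apply_eq
            rw [Equiv.Perm.mul_apply, Equiv.swap_apply_left] at this
            rw [Equiv.symm_apply_eq, this]
          have hlt : k < k' := Fin.lt_def.2 (by omega)
          simp only [Breaking.extract, Ranking.Prefers, h1, h2, hlt, if_true]
          ring
        · simp
      rw [e1, e2, mul_left_comm, sum_levelSorted hb hlev, mul_left_comm (r : ℝ),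
        sum_levelSorted_mul_swap hb hr hk hlev]
      ring
    · rw [if_neg hlev]
      have e1 : ∀ R : Ranking m,
          ¬ (R k = j ∧ LevelSorted R₀ k r (R * Equiv.swap k k')) := by
        rintro R ⟨rfl, hs⟩
        apply hlev
        have := hs k'
        rw [Equiv.Perm.mul_apply, Equiv.swap_apply_right] at this
        rw [this, levelAt_eq_one]
        omega
      simp [hlev, e1]
  have h1 := congrArg (fun x => (r : ℝ) * x) h0
  simp only [mul_zero] at h1
  rw [mul_sum, sum_congr rfl hterm, ← sum_filter, filter_filter] at h1
  have hf : univ.filter (fun j => i ≠ j ∧ level R₀ k r j = 1) =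
      univ.filter (fun j => level R₀ k r j = 1) := by
    ext j
    simp only [mem_filter, mem_univ, true_and, and_iff_right_iff_imp]
    rintro h rfl
    rw [level_eq_two.2 rfl] at h
    omega
  rw [hf, sum_level_eq_one hb, ← mul_sum, sum_sub_distrib, ← sum_mul, ← mul_sum] at h1
  have := (mul_eq_zero.1 h1).resolve_left hMpos.ne'
  linarith

end Identity

/-! ### Necessity: reading the conditions off the identity -/

lemma isWeightedUnion_of_weight_eq {G : Breaking m}
    (h : ∀ k k' l : Fin m, (k' : ℕ) = k + 1 → k < l → G.weight k l = G.weight k k') :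
    G.IsWeightedUnion := by
  classical
  have hlt : ∀ k l : Fin m, k < l → G.weight k l = ∑ q : Fin m, (if hq : (q : ℕ) + 1 < m then
      G.weight q ⟨q + 1, hq⟩ else 0) * (positionBreaking q).weight k l := by
    intro k l hkl
    have hkl' := Fin.lt_def.1 hkl
    have hm : (k : ℕ) + 1 < m := by omega
    rw [sum_eq_single k]
    · simp only [hm, dif_pos, positionBreaking, hkl, and_true, true_or, if_true, mul_one]
      exact h k ⟨k + 1, hm⟩ l rfl hkl
    · intro q _ hq
      have : ¬ ((k = q ∧ q < l) ∨ (l = q ∧ q < k)) := by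
        rintro (⟨rfl, -⟩ | ⟨rfl, h'⟩)
        · exact hq rfl
        · exact lt_asymm hkl h'
      simp [positionBreaking, this]
    · simp
  -- The coefficient of position `q` is the weight of its edge to the next position; the last
  -- position has no such edge and gets `0`.
  refine ⟨fun q => if hq : (q : ℕ) + 1 < m then G.weight q ⟨q + 1, hq⟩ else 0,
    fun q => ?_, fun i j => ?_⟩
  · dsimp only
    split_ifs
    · exact G.nonneg _ _
    · exact le_rfl
  · rcases lt_trichotomy i j with hij | rfl | hij
    · exact hlt i j hij
    · rw [G.loopless]
      exact (sum_eq_zero fun q _ => by rw [(positionBreaking q).loopless, mul_zero]).symm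
    · rw [G.symm, hlt j i hij]
      exact sum_congr rfl fun q _ => by rw [(positionBreaking q).symm]

/-- Since `R₀` is arbitrary, any pair of alternatives can be put at any two positions in the
identity. -/
lemma isWeightedUnion_and_isSymmetric_of_isConsistent {G : Breaking m} {W : CMLWeight m}
    (hG : G.Nonempty) (h : IsConsistent G W) : G.IsWeightedUnion ∧ W.IsSymmetric := by
  have hid := fun (R₀ : Ranking m) (k k' b : Fin m) (r : ℕ) (hk : (k' : ℕ) = k + 1) (hb) (hr) =>
    weight_identity (fun θ a => stationarity_of_isMax W (meanKappa θ G) θ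
      (logLik_le_of_isConsistent h θ) a) R₀ (k := k) (k' := k') (b := b) (r := r) hk hb hr
  obtain ⟨p, q, hpq, hw⟩ := hG.exists_lt
  -- An edge of `G` gives at least two alternatives, so a connected `W` has an edge; otherwise even
  -- the index function would be constant.
  obtain ⟨i, j, hij, hwij⟩ : ∃ i j, i ≠ j ∧ 0 < W.weight i j := by
    by_contra! hcon
    refine absurd (isConnected_const (isConnected_of_isConsistent hG h)
      (d := fun i : Fin m => (i : ℝ)) ?_ p q) ?_
    · exact fun i j hij hw => absurd (hcon i j hij) (not_le.2 hw)
    · simpa using Fin.val_ne_of_ne hpq.ne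
  have hpq' := Fin.lt_def.1 hpq
  -- With `b = q` and `i`, `j` at `p`, `q`, a zero weight here would annihilate the right side of
  -- the identity while the left side stays positive.
  have hpos : 0 < G.weight p ⟨p + 1, by omega⟩ := by
    by_contra! hle
    have h0 : G.weight p ⟨p + 1, by omega⟩ = 0 := le_antisymm hle (G.nonneg _ _)
    obtain ⟨R, rfl, rfl⟩ := exists_ranking hpq.ne hij
    have := hid R p ⟨p + 1, by omega⟩ q (q - p) rfl (by omega) (by omega)
    rw [h0, mul_zero, zero_mul] at this
    have hq : q ∈ Ioc p q := by simp [hpq]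
    have h1 : 0 < ∑ s ∈ Ioc p q, W.weight (R p) (R s) :=
      sum_pos' (fun s _ => W.nonneg _ _) ⟨q, hq, hwij⟩
    have h2 : 0 < ∑ l ∈ Ioc p q, G.weight p l := sum_pos' (fun s _ => G.nonneg _ _) ⟨q, hq, hw⟩
    exact (mul_pos h1 h2).ne' this
  have hIoc : ∀ k k' : Fin m, (k' : ℕ) = k + 1 → Ioc k k' = {k'} := by
    intro k k' hk
    ext s; simp only [mem_Ioc, mem_singleton, Fin.lt_def, Fin.le_def, Fin.ext_iff]; omega
  have hsymm : W.IsSymmetric := by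
    intro i j hij
    have hne : p ≠ (⟨p + 1, by omega⟩ : Fin m) := by simp [Fin.ext_iff]
    obtain ⟨R, hi, hj⟩ := exists_ranking hne hij
    have := hid R p ⟨p + 1, by omega⟩ ⟨p + 1, by omega⟩ 1 rfl rfl le_rfl
    rw [hIoc p _ rfl] at this
    simp only [sum_singleton, hi, hj, Nat.cast_one, one_mul] at this
    rw [mul_comm] at this
    exact mul_left_cancel₀ hpos.ne' this
  refine ⟨isWeightedUnion_of_weight_eq fun k k' l hk hkl => ?_, hsymm⟩
  -- By symmetry the two sums of `W` agree and, being positive, cancel. All initial averages of the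
  -- weights at `k` then equal the first weight, and consecutive values of `r` isolate each one.
  have hsum : ∀ (b : Fin m) (r : ℕ), (b : ℕ) = k + r → 1 ≤ r →
      ∑ l ∈ Ioc k b, G.weight k l = r * G.weight k k' := by
    intro b r hb hr
    have hkb : k < b := Fin.lt_def.2 (by omega)
    obtain ⟨R, rfl, rfl⟩ := exists_ranking hkb.ne hij
    have := hid R k k' b r hk hb hr
    have hs : ∑ s ∈ Ioc k b, W.weight (R s) (R k) = ∑ s ∈ Ioc k b, W.weight (R k) (R s) :=
      sum_congr rfl fun s hs => hsymm _ _ (R.injective.ne (mem_Ioc.1 hs).1.ne')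
    rw [hs, mul_comm] at this
    exact mul_right_cancel₀
      (sum_pos' (fun s _ => W.nonneg _ _) ⟨b, by simp [hkb], hwij⟩).ne' this
  obtain ⟨d, hd⟩ : ∃ d, (l : ℕ) = k + (d + 1) :=
    ⟨l - k - 1, by have := Fin.lt_def.1 hkl; omega⟩
  rcases Nat.eq_zero_or_pos d with rfl | hdpos
  · congr 1
    exact Fin.ext (by omega)
  have hlm := l.isLt
  set b : Fin m := ⟨k + d, by omega⟩ with hb
  have hins : Ioc k l = insert l (Ioc k b) := by
    ext s; simp only [mem_Ioc, mem_insert, Fin.lt_def, Fin.le_def, Fin.ext_iff, hb]; omega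
  have h1 := hsum l (d + 1) hd (by omega)
  rw [hins, sum_insert (by simp only [mem_Ioc, Fin.le_def, hb]; omega), hsum b d rfl hdpos] at h1
  push_cast at h1
  linarith

end RBCML

theorem mainTheorem1 (m : ℕ) (G : RBCML.Breaking m) (W : RBCML.CMLWeight m) (hG : G.Nonempty) :
    RBCML.IsConsistent G W ↔ G.IsWeightedUnion ∧ W.IsConnected ∧ W.IsSymmetric := by
  constructor
  · intro h
    obtain ⟨hU, hs⟩ := RBCML.isWeightedUnion_and_isSymmetric_of_isConsistent hG h
    exact ⟨hU, RBCML.isConnected_of_isConsistent hG h, hs⟩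
  · rintro ⟨hU, hc, hs⟩
    exact RBCML.isConsistent_of hG hU hc hs
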